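/- Let $K$ be a number field with ring of integers $\mathfrak o_K$, let $X$ be a projective variety over $K$, let $P\in X(K)$ be a rational point at which $X$ is smooth, and let $F$ be an algebraic foliation of dimension $d$ on an open subset $U$ of $X$ containing $P$, that is, a subbundle of rank $d$ of the tangent bundle of $U$ which is stable under Lie brackets. Then there is a unique germ of formal leaf $\widehat V$ of $F$ through $P$, that is, a unique smooth formal subscheme of dimension $d$ of the formal completion $\widehat X_P$ which is tangent to $F$, and $\widehat V$ is $1$-analytic. Here, for a maximal ideal $\mathfrak p$ of $\mathfrak o_K$, $|\cdot|_{\mathfrak p}$ is the $\mathfrak p$-adic absolute value for which a uniformizer has absolute value $N(\mathfrak p)^{-1}$. For $a\ge 0$, $G_{\mathrm{an},a}$ is the set of $n$-tuples $f=(f_1,\dots,f_n)$ of power series $f_i=\sum_I f_{i,I}X^I\in K[[X_1,\dots,X_n]]$ with $f(0)=0$ and $Df(0)\in \mathrm{GL}_n(K)$, having a positive radius of convergence at every place of $K$, for which there are a finite set $S$ of places containing all Archimedean ones and real numbers $C_{\mathfrak p}\ge 1$ $(\mathfrak p\notin S)$ with $\prod_{\mathfrak p\notin S}C_{\mathfrak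 p}<\infty$ and $$|f_{i,I}|_{\mathfrak p}\le \frac{C_{\mathfrak p}^{|I|}}{|I!|_{\mathfrak p}^{a}}\qquad\text{for all }\mathfrak p\notin S,\ 1\le i\le n,\ I\in\mathbf Z_{\ge 0}^n .$$ The type $\alpha(X,\widehat V,P)\in[0,\infty]$ of a smooth formal subscheme $\widehat V$ of dimension $d$ of $\widehat X_P$ is the infimum of the $a\ge 0$ such that, after identifying $\widehat X_P$ with the formal completion of $\mathbf A^n_K$ at $0$ by means of étale coordinates of $X$ at $P$ (vanishing at $P$), there is $f\in G_{\mathrm{an},a}$ with $f^*\widehat V=\widehat{\mathbf A}^d\times\{0\}$. One says that $\widehat V$ is $\alpha$-analytic if $\alpha\ge\alpha(X,\widehat V,P)$. -/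

import Mathlib

open AlgebraicGeometry CategoryTheory Opposite
open scoped NNReal ENNReal NumberField

universe u

noncomputable section

namespace FormalLeaf

/-! ### Places of a number field and the groups of analytic formal automorphisms -/

section PowerSeries

variable {K : Type u} [Field K]

/-- The `𝔭`-adic absolute value of a number field `K`, normalized so that a uniformizer has absolute
value `N(𝔭)⁻¹`. -/
def finiteAbs [NumberField K] (p : IsDedekindDomain.HeightOneSpectrum (𝓞 K)) : AbsoluteValue K ℝ :=
  NumberField.HeightOneSpectrum.adicAbv K p

/-- The absolute value `x ↦ |σ x|` of `K` given by a complex embedding `σ`. -/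
def archAbs (σ : K →+* ℂ) (x : K) : ℝ := ‖σ x‖

/-- A power series in several variables has a positive radius of convergence with respect to the
absolute value `abv`: for some `r > 0` the numbers `|g_I| r^|I|` are bounded. -/
def HasPosRadius {n : ℕ} (abv : K → ℝ) (g : MvPowerSeries (Fin n) K) : Prop :=
  ∃ r : ℝ, 0 < r ∧ ∃ M : ℝ, ∀ I : Fin n →₀ ℕ, abv (MvPowerSeries.coeff I g) * r ^ I.degree ≤ M

/-- The factorial `I! = ∏ i_j!` of a multi-index. -/
def multiFactorial {n : ℕ} (I : Fin n →₀ ℕ) : ℕ := ∏ j, (I j).factorial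

/-- `f = (f_1, …, f_n)` is a formal automorphism of the formal completion of `𝔸ⁿ` at `0`: one has
`f(0) = 0` and the Jacobian matrix of `f` at `0` is invertible. -/
structure IsFormalAut {n : ℕ} (f : Fin n → MvPowerSeries (Fin n) K) : Prop where
  map_zero : ∀ i, MvPowerSeries.constantCoeff (f i) = 0
  isUnit_det : IsUnit
    (Matrix.of fun i j : Fin n => MvPowerSeries.coeff (Finsupp.single j 1) (f i)).det

/-- The group `G_an` of formal automorphisms with a positive radius of convergence at each place. -/
structure IsGan [NumberField K] {n : ℕ} (f : Fin n → MvPowerSeries (Fin n) K) : Prop where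
  isFormalAut : IsFormalAut f
  radius_finite : ∀ (p : IsDedekindDomain.HeightOneSpectrum (𝓞 K)) (i : Fin n),
    HasPosRadius (finiteAbs p) (f i)
  radius_arch : ∀ (σ : K →+* ℂ) (i : Fin n), HasPosRadius (archAbs σ) (f i)

/-- The set `G_{an,a}`: the `f ∈ G_an` for which there are a finite set `S` of finite places (the
Archimedean places are always excluded) and real numbers `C_𝔭 ≥ 1`, for `𝔭 ∉ S`, with convergent
product and `|f_{i,I}|_𝔭 ≤ C_𝔭^|I| / |I!|_𝔭^a` for all `𝔭 ∉ S`, all `i` and all `I`. -/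
structure IsGanOfType [NumberField K] {n : ℕ} (a : ℝ≥0) (f : Fin n → MvPowerSeries (Fin n) K) :
    Prop where
  isGan : IsGan f
  bound : ∃ (S : Finset (IsDedekindDomain.HeightOneSpectrum (𝓞 K)))
    (C : {p : IsDedekindDomain.HeightOneSpectrum (𝓞 K) // p ∉ S} → ℝ),
    (∀ p, 1 ≤ C p) ∧ Multipliable C ∧
    ∀ p (i : Fin n) (I : Fin n →₀ ℕ),
      finiteAbs p.1 (MvPowerSeries.coeff I (f i)) ≤
        C p ^ I.degree / (finiteAbs p.1 ((multiFactorial I : ℕ) : K)) ^ (a : ℝ)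

end PowerSeries

/-! ### Schemes over a field -/

section Schemes

variable (K : Type u) [Field K] (X : Scheme.{u}) [X.Over (Spec (.of K))]

/-- The ring homomorphism from `K` to the global sections of a `K`-scheme. -/
def toGlobal : K →+* Γ(X, ⊤) :=
  ((Scheme.ΓSpecIso (.of K)).inv ≫ (X ↘ Spec (.of K)).appTop).hom

/-- The sections of the structure sheaf of a `K`-scheme form a `K`-algebra. -/
instance sectionsAlgebra (W : X.Opens) : Algebra K Γ(X, W) :=
  ((X.presheaf.map (homOfLE le_top : W ⟶ ⊤).op).hom.comp (toGlobal K X)).toAlgebra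

/-- The local rings of a `K`-scheme are `K`-algebras. -/
instance stalkAlgebra (x : X) : Algebra K (X.presheaf.stalk x) :=
  ((X.presheaf.germ ⊤ x trivial).hom.comp (toGlobal K X)).toAlgebra

attribute [local instance] MvPolynomial.gradedAlgebra

/-- Projective space of dimension `N` over `K`. -/
def projectiveSpace (N : ℕ) : Scheme.{u} :=
  Proj (MvPolynomial.homogeneousSubmodule (Fin (N + 1)) K)

/-- The structure morphism of projective space. -/
def projectiveSpaceToSpec (N : ℕ) : projectiveSpace K N ⟶ Spec (.of K) :=
  Proj.toSpecZero (MvPolynomial.homogeneousSubmodule (Fin (N + 1)) K) ≫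
    Spec.map (CommRingCat.ofHom
      (algebraMap K (MvPolynomial.homogeneousSubmodule (Fin (N + 1)) K 0)))

/-- `X` is projective over `K`: it has a closed immersion over `K` in some projective space. -/
def IsProjective : Prop :=
  ∃ (N : ℕ) (i : X ⟶ projectiveSpace K N),
    IsClosedImmersion i ∧ i ≫ projectiveSpaceToSpec K N = X ↘ Spec (.of K)

variable {K X}

/-- The point of the underlying space of `X` given by a morphism `Spec K ⟶ X`. -/
def point (P : Spec (.of K) ⟶ X) : X := P (IsLocalRing.closedPoint K)

variable (K) in
/-- `X` is smooth over `K` at `x`: some open neighbourhood of `x` is smooth over `K`. -/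
def IsSmoothAt (x : X) : Prop :=
  ∃ W : X.Opens, x ∈ W ∧ Smooth (W.ι ≫ X ↘ Spec (.of K))

/-- The complete local ring of `X` at `x`, that is to say the ring of functions of the formal
completion of `X` at `x`. -/
abbrev completedStalk (x : X) : Type u :=
  AdicCompletion (IsLocalRing.maximalIdeal (X.presheaf.stalk x)) (X.presheaf.stalk x)

variable (K) in
/-- The Taylor expansion at `x` of a section of the structure sheaf over a neighbourhood of `x`. -/
def expand (x : X) (W : X.Opens) (hx : x ∈ W) : Γ(X, W) →ₐ[K] completedStalk x where
  toRingHom := (algebraMap (X.presheaf.stalk x) (completedStalk x)).comp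
    (X.presheaf.germ W x hx).hom
  commutes' c := by
    have h : (X.presheaf.germ W x hx).hom (algebraMap K Γ(X, W) c) =
        algebraMap K (X.presheaf.stalk x) c := by
      change (X.presheaf.germ W x hx).hom
        ((X.presheaf.map (homOfLE le_top : W ⟶ ⊤).op).hom (toGlobal K X c)) =
          (X.presheaf.germ ⊤ x trivial).hom (toGlobal K X c)
      exact X.presheaf.germ_res_apply (homOfLE le_top) x hx _
    change algebraMap (X.presheaf.stalk x) (completedStalk x) ((X.presheaf.germ W x hx).hom _) = _
    rw [h]
    rfl

end Schemes

/-! ### Algebraic foliations -/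

section Foliations

variable (K : Type u) [Field K] (X : Scheme.{u}) [X.Over (Spec (.of K))]

/-- The vector fields on the open subset `W` of `X`, for `W` affine: the `K`-derivations of
the ring of functions of `W`. -/
abbrev VectorField (W : X.Opens) : Type u := Derivation K Γ(X, W) Γ(X, W)

variable {K X}

/-- The vector field `D'` on `W'` is the restriction to `W' ⊆ W` of the vector field `D` on `W`. -/
def IsRestriction {W W' : X.Opens} (h : W' ≤ W) (D : VectorField K X W)
    (D' : VectorField K X W') : Prop :=
  ∀ s : Γ(X, W), D' ((X.presheaf.map (homOfLE h).op).hom s) =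
    (X.presheaf.map (homOfLE h).op).hom (D s)

variable (K X)

/-- A (regular) algebraic foliation of dimension `d` on the open subset `U` of `X`: an involutive
subbundle of rank `d` of the tangent bundle of `U`. It is given by its modules of sections over the
affine open subsets of `U`; these are compatible with restriction (quasi-coherence), they
are, locally on `U`, free of rank `d` and direct summands of the tangent sheaf (subbundle of rank
`d`), and they are stable under Lie brackets (involutivity). -/
structure AlgFoliation (U : X.Opens) (d : ℕ) where
  /-- the vector fields over an affine open subset `W` of `U` that belong to the foliation -/
  fields (W : X.Opens) (hW : IsAffineOpen W) (hWU : W ≤ U) : Submodule Γ(X, W) (VectorField K X W)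
  fields_restrict : ∀ (W W' : X.Opens) (hW : IsAffineOpen W) (hW' : IsAffineOpen W')
    (hWU : W ≤ U) (h : W' ≤ W), fields W' hW' (h.trans hWU) =
      Submodule.span Γ(X, W') {D' | ∃ D ∈ fields W hW hWU, IsRestriction h D D'}
  subbundle : ∀ x ∈ U, ∃ (W : X.Opens) (hW : IsAffineOpen W) (hWU : W ≤ U), x ∈ W ∧
    Nonempty (Module.Basis (Fin d) Γ(X, W) (fields W hW hWU)) ∧
    ∃ G : Submodule Γ(X, W) (VectorField K X W), IsCompl (fields W hW hWU) G
  involutive : ∀ (W : X.Opens) (hW : IsAffineOpen W) (hWU : W ≤ U),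
    ∀ D ∈ fields W hW hWU, ∀ E ∈ fields W hW hWU, ⁅D, E⁆ ∈ fields W hW hWU

end Foliations

/-! ### Smooth formal subschemes, formal leaves, analyticity -/

section Formal

variable (K : Type u) [Field K] {X : Scheme.{u}} [X.Over (Spec (.of K))]

/-- The closed formal subscheme with ideal `J` of the formal completion of `X` at the rational point
`x` is smooth of dimension `d`: its ring of functions is isomorphic to `K[[t_1, …, t_d]]`. -/
def IsSmoothFormalSubscheme (x : X) (d : ℕ) (J : Ideal (completedStalk x)) : Prop :=
  Nonempty ((completedStalk x ⧸ J) ≃ₐ[K] MvPowerSeries (Fin d) K)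

/-- The formal subscheme `V` with ideal `J` is tangent to the vector field `D`: the restriction to
`V` of `D`, seen as a derivation with values in the functions on `V`, is induced by a vector field
`E` on `V`. -/
def IsTangent {x : X} (J : Ideal (completedStalk x)) {W : X.Opens} (hx : x ∈ W)
    (D : VectorField K X W) : Prop :=
  ∃ E : Derivation K (completedStalk x ⧸ J) (completedStalk x ⧸ J), ∀ s : Γ(X, W),
    E (Ideal.Quotient.mk J (expand K x W hx s)) = Ideal.Quotient.mk J (expand K x W hx (D s))

variable {K}

/-- The formal subscheme with ideal `J` is the germ of formal leaf through `x` of the foliation `F`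
of dimension `d`: it is smooth of dimension `d` and tangent to `F` (so that, the dimensions being
equal, its tangent bundle is the restriction of `F`). -/
structure IsFormalLeaf {U : X.Opens} {d : ℕ} (F : AlgFoliation K X U d) (x : X)
    (J : Ideal (completedStalk x)) : Prop where
  smooth : IsSmoothFormalSubscheme K x d J
  tangent : ∀ (W : X.Opens) (hW : IsAffineOpen W) (hWU : W ≤ U) (hx : x ∈ W),
    ∀ D ∈ F.fields W hW hWU, IsTangent K J hx D

variable (K)

/-- Étale coordinates at the point `x` of `X`: regular functions on an affine open neighbourhood
`W` of `x` that vanish at `x` and define an étale morphism from `W` to `𝔸ⁿ`. -/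
structure EtaleCoords (x : X) (n : ℕ) where
  W : X.Opens
  isAffine : IsAffineOpen W
  mem : x ∈ W
  coord : Fin n → Γ(X, W)
  vanish : ∀ i, X.presheaf.germ W x mem (coord i) ∈
    IsLocalRing.maximalIdeal (X.presheaf.stalk x)
  etale : RingHom.Etale (MvPolynomial.aeval (R := K) coord).toRingHom

variable {K}

/-- `f : 𝔸̂ⁿ ⟶ X̂_x` is an isomorphism (given as the isomorphism `θ` of rings of functions)
whose expression in the étale coordinates `c` is `(f_1, …, f_n)`, and the inverse image by `f` of
the formal subscheme `V` with ideal `J` is `𝔸̂ᵈ × {0}`, the formal subscheme with equations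
`X_{d+1} = … = X_n = 0`. (The étale morphism given by `c` identifies the formal completion of `X`
at the rational point `x` with `𝔸̂ⁿ`, so this says that `f^* V = 𝔸̂ᵈ` for the formal automorphism
`f = (f_1, …, f_n)` of `𝔸̂ⁿ`.) -/
def Straightens {x : X} {n : ℕ} (c : EtaleCoords K x n) (f : Fin n → MvPowerSeries (Fin n) K)
    (d : ℕ) (J : Ideal (completedStalk x)) : Prop :=
  ∃ θ : completedStalk x ≃ₐ[K] MvPowerSeries (Fin n) K,
    (∀ i, θ (expand K x c.W c.mem (c.coord i)) = f i) ∧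
    J.map (θ : completedStalk x →+* MvPowerSeries (Fin n) K) =
      Ideal.span {g | ∃ j : Fin n, d ≤ (j : ℕ) ∧ g = MvPowerSeries.X j}

variable (K) in
/-- The number `α(X, V, P) ∈ [0, ∞]` of the formal subscheme `V` of dimension `d` with ideal `J` of
the formal completion of `X` at the smooth rational point `x`: the infimum of the `a ≥ 0` such
that, in étale coordinates at `x`, there is `f ∈ G_{an,a}` with `f^* V = 𝔸̂ᵈ`. -/
def analyticityType [NumberField K] (x : X) (d : ℕ) (J : Ideal (completedStalk x)) : ℝ≥0∞ :=
  sInf {α | ∃ a : ℝ≥0, α = a ∧ ∃ (n : ℕ) (c : EtaleCoords K x n)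
    (f : Fin n → MvPowerSeries (Fin n) K), IsGanOfType a f ∧ Straightens c f d J}

variable (K) in
/-- The formal subscheme of dimension `d` with ideal `J` is `α`-analytic. -/
def IsAnalyticOfType [NumberField K] (α : ℝ≥0) (x : X) (d : ℕ) (J : Ideal (completedStalk x)) :
    Prop :=
  analyticityType K x d J ≤ α

end Formal

end FormalLeaf

end

/-!
The point `P` has étale coordinates `y_1, …, y_n` (`exists_etaleCoords`). The vector fields
`∂/∂y_j` commute, so Taylor expansion along them identifies the complete local ring of `X` at `P`
with `K[[X_1, …, X_n]]` (`exists_etale_completion`). The foliation enters only through the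
derivations of the local ring that it generates; they do not depend on the affine neighbourhood on
which the foliation is read (`stalkFields_eq`). On a suitable neighbourhood they are spanned by the
germs of a basis of a direct summand of the module of vector fields, so that the values at `P` of
this basis are linearly independent (`eq_zero_of_isCompl`). After a permutation of the coordinates,
inverting a minor gives a new basis `D_1, …, D_d` with `D_i y_j = δ_ij` for `j ≤ d`. The bracket
`[D_i, D_j]` is a combination of the `D_k` that kills `y_1, …, y_d`, hence it vanishes
(`exists_commuting_frame`).

The leaf is then obtained by integrating the commuting frame at `P`. Taylor expansion along
`D_1, …, D_d` is a surjective homomorphism `φ` onto `K[[t_1, …, t_d]]` that turns `D_i` into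
`∂/∂t_i` (`exists_formal_leaf`), and its kernel is the ideal of a leaf. Conversely, a proper ideal
stable under the `D_i` consists of functions all of whose iterated derivatives vanish at `P`, so it
lies in the kernel of `φ`; if it defines a smooth formal subscheme of dimension `d`, the resulting
surjection between two copies of `K[[t_1, …, t_d]]` is an isomorphism (`eq_ker_of_stable`). This
gives existence and uniqueness (`exists_unique_leaf`).

The leaf is the graph of the series `g_j = φ(y_j)`, `j > d`, and it is straightened by the
automorphism `X_j ↦ X_j + g_j(X_1, …, X_d)` of the formal affine space (`graphAut`). The number
`I! g_{j,I}` is the value at `P` of a function obtained from `y_j` by applying `|I|` of the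
derivations `D_i`. Since these are defined over an algebra of finite type
(`exists_stable_subalgebra`), they lift to polynomial vector fields on an affine space
(`exists_polynomial_lift`). At almost all places the lifted vector fields and functions have
integral coefficients, whence `|g_{j,I}| ≤ 1 / |I!|`: this is the bound that defines `G_{an,1}`,
with all constants equal to `1`. At every place, the iterated derivatives of order `k` are bounded
by `C ^ (k + 1) * k!`, and by `C ^ (k + 1)` if the place is ultrametric (`exists_bound_iterWord`,
`exists_bound_iterWord_of_nonarch`), so the radii of convergence are positive. Hence
`graphAut` belongs to `G_{an,1}` (`isGanOfType_graphAut`).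
-/

namespace FormalLeaf

/-! ### Power series: powers of the maximal ideal, continuity -/

section FormalCalculus

open MvPowerSeries

variable {σ τ K : Type*} [Field K]

/-- The ideal of the power series without constant term. -/
noncomputable abbrev augIdeal (σ K : Type*) [Field K] : Ideal (MvPowerSeries σ K) :=
  RingHom.ker (constantCoeff (σ := σ) (R := K))

theorem X_mem_augIdeal (i : σ) : (X i : MvPowerSeries σ K) ∈ augIdeal σ K := by
  simp [RingHom.mem_ker]

/-- A homomorphism of `K`-algebras from a ring of power series to another one is local: if `f` has
no constant term and `φ f` had the constant term `c ≠ 0`, the unit `f - c` would be sent to a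
non-unit. -/
theorem algHom_mem_augIdeal (φ : MvPowerSeries σ K →ₐ[K] MvPowerSeries τ K)
    {f : MvPowerSeries σ K} (hf : f ∈ augIdeal σ K) : φ f ∈ augIdeal τ K := by
  by_contra h
  set c := constantCoeff (φ f) with hc
  have hc0 : c ≠ 0 := h
  have hu : IsUnit (f - algebraMap K _ c) := by
    rw [isUnit_iff_constantCoeff, map_sub, RingHom.mem_ker.1 hf, MvPowerSeries.algebraMap_apply]
    simpa using hc0
  have := hu.map φ
  rw [isUnit_iff_constantCoeff, map_sub, map_sub, AlgHom.commutes,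
    MvPowerSeries.algebraMap_apply] at this
  simp [← hc] at this

theorem algHom_mem_augIdeal_pow (φ : MvPowerSeries σ K →ₐ[K] MvPowerSeries τ K)
    {f : MvPowerSeries σ K} {k : ℕ} (hf : f ∈ augIdeal σ K ^ k) : φ f ∈ augIdeal τ K ^ k := by
  have h : (augIdeal σ K ^ k).map (φ : MvPowerSeries σ K →+* MvPowerSeries τ K) ≤
      augIdeal τ K ^ k := by
    rw [Ideal.map_pow]
    refine Ideal.pow_right_mono (Ideal.map_le_iff_le_comap.2 fun g hg => ?_) k
    exact Ideal.mem_comap.2 (algHom_mem_augIdeal φ hg)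
  exact h (Ideal.mem_map_of_mem _ hf)

theorem constantCoeff_algHom (φ : MvPowerSeries σ K →ₐ[K] MvPowerSeries τ K)
    (f : MvPowerSeries σ K) : constantCoeff (φ f) = constantCoeff f := by
  have h : f - algebraMap K _ (constantCoeff f) ∈ augIdeal σ K := by
    simp [RingHom.mem_ker, MvPowerSeries.algebraMap_apply]
  have := RingHom.mem_ker.1 (algHom_mem_augIdeal φ h)
  rw [map_sub, map_sub, AlgHom.commutes, MvPowerSeries.algebraMap_apply, sub_eq_zero] at this
  simpa using this

/-- A derivation lowers the order of vanishing by at most one. -/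
theorem derivation_mem_pow_smul {A M : Type*} [CommRing A] [Algebra K A] [AddCommGroup M]
    [Module A M] [Module K M] (D : Derivation K A M) (I : Ideal A) (k : ℕ)
    {f : A} (hf : f ∈ I ^ (k + 1)) : D f ∈ (I ^ k • ⊤ : Submodule A M) := by
  induction k generalizing f with
  | zero => simp
  | succ k ih =>
    rw [pow_succ] at hf
    refine Submodule.mul_induction_on hf ?_ ?_
    · intro a ha b hb
      rw [D.leibniz]
      refine Submodule.add_mem _ (Submodule.smul_mem_smul ha trivial) ?_
      have := Submodule.smul_mem_smul hb (ih ha)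
      rwa [← Submodule.mul_smul, ← pow_succ'] at this
    · intro a b ha hb
      rw [map_add]
      exact Submodule.add_mem _ ha hb

/-- A power series each of whose monomials involves a variable of `S` is a combination of the
variables of `S`, with coefficients made of coefficients of the given series. -/
theorem exists_eq_sum_X_mul (S : Finset σ) (f : MvPowerSeries σ K)
    (hf : ∀ I : σ →₀ ℕ, (∀ j ∈ S, I j = 0) → coeff I f = 0) :
    ∃ g : σ → MvPowerSeries σ K, f = ∑ j ∈ S, X j * g j ∧
      ∀ j I, coeff I (g j) = 0 ∨ coeff I (g j) = coeff (I + Finsupp.single j 1) f := by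
  classical
  induction S using Finset.induction_on generalizing f with
  | empty => exact ⟨0, by ext I; simpa using hf I (by simp), fun _ _ => Or.inl rfl⟩
  | insert j S hj ih =>
    let f₂ : MvPowerSeries σ K := fun I => if I j = 0 then coeff I f else 0
    have hf₂ (I : σ →₀ ℕ) : coeff I f₂ = if I j = 0 then coeff I f else 0 := rfl
    let h : MvPowerSeries σ K := fun I => coeff (I + Finsupp.single j 1) f
    have hh (I : σ →₀ ℕ) : coeff I h = coeff (I + Finsupp.single j 1) f := rfl
    obtain ⟨g, hg, hg'⟩ := ih f₂ (by
      intro I hI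
      rw [hf₂]
      split_ifs with h0
      · exact hf I (by simpa [h0] using hI)
      · rfl)
    have hsplit : f = X j * h + f₂ := by
      ext I
      rw [map_add, hf₂]
      by_cases h0 : I j = 0
      · simp [h0, X_def, coeff_monomial_mul]
      · have hle : Finsupp.single j 1 ≤ I := by
          rw [Finsupp.single_le_iff]; omega
        simp [h0, X_def, coeff_monomial_mul, hle, hh, tsub_add_cancel_of_le hle]
    refine ⟨Function.update g j h, ?_, ?_⟩
    · rw [Finset.sum_insert hj, Function.update_self]
      rw [Finset.sum_congr rfl (g := fun i => X i * g i)]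
      · rw [← hg]; exact hsplit
      · intro i hi
        rw [Function.update_of_ne (by rintro rfl; exact hj hi)]
    · intro i I
      by_cases hi : i = j
      · subst hi
        exact Or.inr (by rw [Function.update_self, hh])
      · rw [Function.update_of_ne hi]
        rcases hg' i I with h1 | h1
        · exact Or.inl h1
        · rw [hf₂] at h1
          split_ifs at h1
          · exact Or.inr h1
          · exact Or.inl h1

variable [Fintype σ]

/-- The powers of the augmentation ideal are described by the order of vanishing. -/
theorem mem_augIdeal_pow {k : ℕ} {f : MvPowerSeries σ K} :
    f ∈ augIdeal σ K ^ k ↔ ∀ I : σ →₀ ℕ, I.degree < k → coeff I f = 0 := by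
  classical
  constructor
  · intro hf
    have key : (k : ℕ∞) ≤ f.order := by
      induction k generalizing f with
      | zero => simp
      | succ k ih =>
        rw [pow_succ] at hf
        refine Submodule.mul_induction_on hf ?_ ?_
        · intro a ha b hb
          have h1 : (1 : ℕ∞) ≤ b.order := one_le_order_iff_constCoeff_eq_zero.2 hb
          push_cast
          exact (add_le_add (ih ha) h1).trans le_order_mul
        · intro a b ha hb
          exact (le_min ha hb).trans min_order_le_add
    intro I hI
    exact coeff_of_lt_order (lt_of_lt_of_le (by exact_mod_cast hI) key)
  · induction k generalizing f with
    | zero => simp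
    | succ k ih =>
      intro hf
      obtain ⟨g, hg, hg'⟩ := exists_eq_sum_X_mul Finset.univ f (by
        intro I hI
        have : I = 0 := by ext j; exact hI j (Finset.mem_univ j)
        exact hf I (by simp [this]))
      rw [hg, pow_succ']
      refine Ideal.sum_mem _ fun j _ => Ideal.mul_mem_mul (X_mem_augIdeal j) (ih fun I hI => ?_)
      rcases hg' j I with h | h
      · exact h
      · rw [h]
        exact hf _ (by simpa using hI)

/-- The powers of the augmentation ideal have zero intersection. -/
theorem eq_zero_of_forall_mem_augIdeal_pow {f : MvPowerSeries σ K}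
    (h : ∀ k, f ∈ augIdeal σ K ^ k) : f = 0 := by
  ext I
  exact mem_augIdeal_pow.1 (h (I.degree + 1)) I (Nat.lt_succ_self _)

/-- Polynomials are dense among the power series. -/
theorem exists_polynomial_sub_mem (f : MvPowerSeries σ K) (k : ℕ) :
    ∃ p : MvPolynomial σ K, f - p ∈ augIdeal σ K ^ k := by
  classical
  refine ⟨truncTotal k f, mem_augIdeal_pow.2 fun I hI => ?_⟩
  rw [map_sub, MvPolynomial.coeff_coe, coeff_truncTotal _ hI, sub_self]

/-- Homomorphisms of algebras between rings of power series are continuous, so they are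
determined by the images of the variables. -/
theorem algHom_ext_X [Fintype τ] {φ ψ : MvPowerSeries σ K →ₐ[K] MvPowerSeries τ K}
    (h : ∀ i, φ (X i) = ψ (X i)) : φ = ψ := by
  have hpoly (p : MvPolynomial σ K) : φ p = ψ p := by
    have : φ.comp (MvPolynomial.coeToMvPowerSeries.algHom K) =
        ψ.comp (MvPolynomial.coeToMvPowerSeries.algHom K) := by
      ext i
      simp [h i]
    simpa using DFunLike.congr_fun this p
  ext1 f
  rw [← sub_eq_zero]
  refine eq_zero_of_forall_mem_augIdeal_pow fun k => ?_
  obtain ⟨p, hp⟩ := exists_polynomial_sub_mem f k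
  have : φ f - ψ f = φ (f - p) - ψ (f - p) := by rw [map_sub, map_sub, hpoly]; ring
  rw [this]
  exact Ideal.sub_mem _ (algHom_mem_augIdeal_pow φ hp) (algHom_mem_augIdeal_pow ψ hp)

/-- A derivation of a ring of power series with values in a separated module is determined by
the images of the variables. -/
theorem derivation_eq_zero {M : Type*} [AddCommGroup M] [Module (MvPowerSeries σ K) M]
    [Module K M] (D : Derivation K (MvPowerSeries σ K) M)
    (hM : ∀ m : M, (∀ k, m ∈ (augIdeal σ K ^ k • ⊤ : Submodule (MvPowerSeries σ K) M)) → m = 0)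
    (h : ∀ i, D (X i) = 0) : D = 0 := by
  have hpoly (p : MvPolynomial σ K) : D p = 0 := by
    induction p using MvPolynomial.induction_on with
    | C a =>
      rw [MvPolynomial.coe_C]
      have : (C a : MvPowerSeries σ K) = algebraMap K _ a := by
        simp [MvPowerSeries.algebraMap_apply]
      rw [this, D.map_algebraMap]
    | add p q hp hq => rw [MvPolynomial.coe_add, map_add, hp, hq, add_zero]
    | mul_X p i hp => rw [MvPolynomial.coe_mul, D.leibniz, hp, MvPolynomial.coe_X, h]; simp
  ext f
  refine hM _ fun k => ?_
  obtain ⟨p, hp⟩ := exists_polynomial_sub_mem f (k + 1)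
  have := derivation_mem_pow_smul D _ k hp
  rwa [map_sub, hpoly, sub_zero] at this

/-- A surjective endomorphism of the `K`-algebra of power series is injective: it induces surjective
endomorphisms of the quotients by the powers of the augmentation ideal, which are vector spaces of
finite dimension. -/
theorem algHom_injective_of_surjective (φ : MvPowerSeries σ K →ₐ[K] MvPowerSeries σ K)
    (h : Function.Surjective φ) : Function.Injective φ := by
  rw [injective_iff_map_eq_zero]
  intro f hf
  refine eq_zero_of_forall_mem_augIdeal_pow fun k => ?_
  let I := augIdeal σ K ^ k
  have hfin : Module.Finite K (MvPowerSeries σ K ⧸ I) := by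
    let L : (MvPowerSeries σ K) →ₗ[K] ({e : σ →₀ ℕ // e.degree < k} → K) :=
      LinearMap.pi fun e => coeff e.1
    have hker : (I.restrictScalars K) = LinearMap.ker L := by
      ext g
      simp only [Submodule.restrictScalars_mem, LinearMap.mem_ker, I, mem_augIdeal_pow]
      constructor
      · intro hg; funext e; exact hg e.1 e.2
      · intro hg e he; exact congr_fun hg ⟨e, he⟩
    have : Finite {e : σ →₀ ℕ // e.degree < k} :=
      (Finsupp.finite_of_degree_le (σ := σ) k).subset (fun e (he : e.degree < k) => he.le)
    have : Module.Finite K (MvPowerSeries σ K ⧸ LinearMap.ker L) :=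
      Module.Finite.equiv (LinearMap.quotKerEquivRange L).symm
    exact Module.Finite.equiv (Submodule.quotEquivOfEq _ _ hker.symm ≪≫ₗ
      (Submodule.Quotient.restrictScalarsEquiv K I))
  let φ' : (MvPowerSeries σ K ⧸ I) →ₐ[K] (MvPowerSeries σ K ⧸ I) :=
    Ideal.quotientMapₐ I φ fun g hg => algHom_mem_augIdeal_pow φ hg
  have hs : Function.Surjective φ' := by
    intro y
    obtain ⟨y, rfl⟩ := Ideal.Quotient.mk_surjective y
    obtain ⟨x, rfl⟩ := h y
    exact ⟨Ideal.Quotient.mk I x, rfl⟩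
  have hi : Function.Injective φ' :=
    (LinearMap.injective_iff_surjective (f := φ'.toLinearMap)).2 hs
  refine Ideal.Quotient.eq_zero_iff_mem.1 (hi ?_)
  rw [map_zero]
  change Ideal.Quotient.mk I (φ f) = 0
  rw [hf, map_zero]

end FormalCalculus

/-! ### Taylor expansion along commuting vector fields -/

section Taylor

open MvPowerSeries

/-- The iterate `D_{i_1} ∘ ⋯ ∘ D_{i_k}` of a family of operators along the word `i_1 ⋯ i_k`. -/
def iterWord {ι A : Type*} (D : ι → A → A) (w : List ι) (a : A) : A :=
  w.foldr (fun i b => D i b) a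

theorem iterWord_append_singleton {ι A : Type*} (D : ι → A → A) (w : List ι) (i : ι) (a : A) :
    iterWord D (w ++ [i]) a = iterWord D w (D i a) := by
  simp [iterWord]

theorem map_iterWord {ι A B : Type*} {D : ι → A → A} {E : ι → B → B} (φ : A → B)
    (h : ∀ i a, φ (D i a) = E i (φ a)) (w : List ι) (a : A) :
    φ (iterWord D w a) = iterWord E w (φ a) := by
  induction w with
  | nil => rfl
  | cons i w ih => simp only [iterWord, List.foldr_cons] at ih ⊢; rw [h, ih]

theorem multiFactorial_add_single {n : ℕ} (I : Fin n →₀ ℕ) (i : Fin n) :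
    multiFactorial (I + Finsupp.single i 1) = multiFactorial I * (I i + 1) := by
  classical
  simp only [multiFactorial]
  rw [← Finset.mul_prod_erase _ _ (Finset.mem_univ i),
    ← Finset.mul_prod_erase (a := i) _ (fun j => (I j).factorial) (Finset.mem_univ i)]
  rw [Finset.prod_congr rfl (g := fun j => (I j).factorial)]
  · simp [Nat.factorial_succ]; ring
  · intro j hj
    have : i ≠ j := (Finset.ne_of_mem_erase hj).symm
    simp [this]

theorem multiFactorial_ne_zero {n : ℕ} (I : Fin n →₀ ℕ) : multiFactorial I ≠ 0 :=
  Finset.prod_ne_zero_iff.2 fun _ _ => Nat.factorial_ne_zero _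

variable {K : Type*} [Field K] {d : ℕ}

/-- The coefficients of a power series are the values at the origin of its iterated derivatives,
divided by factorials. -/
theorem exists_word_constantCoeff (I : Fin d →₀ ℕ) : ∃ w : List (Fin d), w.length = I.degree ∧
    ∀ g : MvPowerSeries (Fin d) K, constantCoeff (iterWord (fun i => pderiv K i) w g) =
      (multiFactorial I : K) * coeff I g := by
  induction hk : I.degree generalizing I with
  | zero =>
    have : I = 0 := (Finsupp.degree_eq_zero_iff I).1 hk
    subst this
    exact ⟨[], rfl, fun g => by simp [iterWord, multiFactorial]⟩
  | succ k ih =>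
    obtain ⟨i, hi⟩ : ∃ i, I i ≠ 0 := by
      by_contra! h
      have : I = 0 := Finsupp.ext h
      simp [this] at hk
    have hle : Finsupp.single i 1 ≤ I := by rw [Finsupp.single_le_iff]; omega
    obtain ⟨I, rfl⟩ : ∃ I', I = I' + Finsupp.single i 1 :=
      ⟨I - Finsupp.single i 1, (tsub_add_cancel_of_le hle).symm⟩
    obtain ⟨w, hw, h⟩ := ih I (by simpa using hk)
    refine ⟨w ++ [i], by simp [hw], fun g => ?_⟩
    rw [iterWord_append_singleton, h, coeff_pderiv, multiFactorial_add_single]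
    push_cast
    ring

variable [CharZero K]

/-- A power series vanishes as soon as all its iterated derivatives vanish at the origin. -/
theorem eq_zero_of_forall_word {g : MvPowerSeries (Fin d) K}
    (h : ∀ w : List (Fin d), constantCoeff (iterWord (fun i => pderiv K i) w g) = 0) : g = 0 := by
  ext I
  obtain ⟨w, -, hw⟩ := exists_word_constantCoeff (K := K) I
  have h0 := h w
  rw [hw, mul_eq_zero] at h0
  exact h0.resolve_left (Nat.cast_ne_zero.2 (multiFactorial_ne_zero I))

variable {A : Type*} [CommRing A] [Algebra K A]

/-- The linear map underlying Taylor expansion along commuting derivations: the coefficient of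
`t ^ I` in the expansion of `a` is the value of `D ^ I a`, divided by `I!`. -/
theorem exists_taylor_linearMap (D : Fin d → Derivation K A A)
    (hD : ∀ i j a, D i (D j a) = D j (D i a)) (ev : A →ₗ[K] K) :
    ∃ T : A →ₗ[K] MvPowerSeries (Fin d) K, (∀ a, constantCoeff (T a) = ev a) ∧
      ∀ i a, T (D i a) = pderiv K i (T a) := by
  classical
  let E : Fin d → Module.End K A := fun i => (D i : A →ₗ[K] A)
  have hE (i j : Fin d) : Commute (E i) (E j) := LinearMap.ext fun a => hD i j a
  let ϕ : (i : Fin d) → Multiplicative ℕ →* Module.End K A := fun i => powersHom _ (E i)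
  have hϕ : Pairwise fun i j => ∀ x y, Commute (ϕ i x) (ϕ j y) := by
    intro i j _ x y
    exact ((hE i j).pow_pow _ _)
  let C : (Fin d →₀ ℕ) → Module.End K A := fun I =>
    MonoidHom.noncommPiCoprod ϕ hϕ fun i => Multiplicative.ofAdd (I i)
  have hC0 : C 0 = 1 := map_one (MonoidHom.noncommPiCoprod ϕ hϕ)
  have hC (I : Fin d →₀ ℕ) (i : Fin d) : C (I + Finsupp.single i 1) = C I * E i := by
    have : (fun j => Multiplicative.ofAdd ((I + Finsupp.single i 1 : Fin d →₀ ℕ) j)) =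
        (fun j => Multiplicative.ofAdd (I j)) * Pi.mulSingle i (Multiplicative.ofAdd 1) := by
      funext j
      by_cases h : j = i
      · subst h; simp [ofAdd_add]
      · simp [h]
    simp only [C]
    rw [this, map_mul, MonoidHom.noncommPiCoprod_mulSingle]
    simp [ϕ, powersHom_apply]
  let T : A →ₗ[K] MvPowerSeries (Fin d) K :=
    { toFun := fun a I => (multiFactorial I : K)⁻¹ * ev (C I a)
      map_add' := fun a b => by
        funext I
        change _ = (multiFactorial I : K)⁻¹ * ev (C I a) + (multiFactorial I : K)⁻¹ * ev (C I b)
        rw [map_add, map_add, mul_add]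
      map_smul' := fun c a => by
        funext I
        change _ = c * ((multiFactorial I : K)⁻¹ * ev (C I a))
        simp; ring }
  have hT (a : A) (I : Fin d →₀ ℕ) :
      coeff I (T a) = (multiFactorial I : K)⁻¹ * ev (C I a) := rfl
  refine ⟨T, fun a => ?_, fun i a => ?_⟩
  · rw [← coeff_zero_eq_constantCoeff_apply, hT, hC0]
    simp [multiFactorial]
  · ext I
    have h1 : (multiFactorial I : K) ≠ 0 := Nat.cast_ne_zero.2 (multiFactorial_ne_zero I)
    have h2 : ((I i : K) + 1) ≠ 0 := by exact_mod_cast Nat.succ_ne_zero (I i)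
    rw [coeff_pderiv, hT, hT, hC, multiFactorial_add_single]
    change _ * ev (C I (D i a)) = _ * ev (C I (D i a)) * _
    push_cast
    field_simp

/-- Taylor expansion along commuting derivations `D_i` at a rational point is a homomorphism of
algebras, which transforms `D_i` into `∂/∂t_i`: both sides of the multiplicativity satisfy the
Leibniz rule, so that all their derivatives at the origin agree. -/
theorem exists_taylor (D : Fin d → Derivation K A A)
    (hD : ∀ i j a, D i (D j a) = D j (D i a)) (ev : A →ₐ[K] K) :
    ∃ T : A →ₐ[K] MvPowerSeries (Fin d) K, (∀ a, constantCoeff (T a) = ev a) ∧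
      ∀ i a, T (D i a) = pderiv K i (T a) := by
  obtain ⟨T, hT, hT'⟩ := exists_taylor_linearMap D hD ev.toLinearMap
  have iter_add (w : List (Fin d)) (f g : MvPowerSeries (Fin d) K) :
      iterWord (fun i => pderiv K i) w (f + g) =
        iterWord (fun i => pderiv K i) w f + iterWord (fun i => pderiv K i) w g := by
    induction w with
    | nil => rfl
    | cons i w ih =>
      simp only [iterWord, List.foldr_cons] at ih ⊢
      rw [ih, map_add]
  have hmul (w : List (Fin d)) : ∀ a b,
      constantCoeff (iterWord (fun i => pderiv K i) w (T (a * b) - T a * T b)) = 0 := by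
    induction w using List.reverseRecOn with
    | nil => intro a b; simp [iterWord, hT]
    | append_singleton w i ih =>
      intro a b
      have h : pderiv K i (T (a * b) - T a * T b) =
          (T (a * D i b) - T a * T (D i b)) + (T (b * D i a) - T b * T (D i a)) := by
        rw [map_sub, ← hT', (D i).leibniz, (pderiv K i).leibniz, map_add, hT', hT']
        simp only [smul_eq_mul]
        ring
      rw [iterWord_append_singleton, h, iter_add, map_add, ih, ih, add_zero]
  have hone (w : List (Fin d)) :
      constantCoeff (iterWord (fun i => pderiv K i) w (T 1 - 1)) = 0 := by
    have h0 (w : List (Fin d)) : iterWord (fun i => pderiv K i) w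
        (0 : MvPowerSeries (Fin d) K) = 0 := by
      induction w with
      | nil => rfl
      | cons i w ih => simp only [iterWord, List.foldr_cons] at ih ⊢; rw [ih, map_zero]
    induction w using List.reverseRecOn with
    | nil => simp [iterWord, hT]
    | append_singleton w i _ =>
      have h : pderiv K i (T 1 - 1) = 0 := by
        rw [map_sub, ← hT', (D i).map_one_eq_zero, (pderiv K i).map_one_eq_zero, map_zero,
          sub_zero]
      rw [iterWord_append_singleton, h, h0, map_zero]
  exact ⟨AlgHom.ofLinearMap T (sub_eq_zero.1 (eq_zero_of_forall_word hone))
    fun a b => sub_eq_zero.1 (eq_zero_of_forall_word fun w => hmul w a b), hT, hT'⟩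

end Taylor

/-! ### Formal Frobenius theorem -/

section Frobenius

open MvPowerSeries

/-- A derivation that preserves an ideal acts on the quotient. -/
theorem exists_derivation_quotient {K A : Type*} [CommRing K] [CommRing A] [Algebra K A]
    (D : Derivation K A A) (J : Ideal A) (hJ : ∀ f ∈ J, D f ∈ J) :
    ∃ E : Derivation K (A ⧸ J) (A ⧸ J), ∀ a,
      E (Ideal.Quotient.mk J a) = Ideal.Quotient.mk J (D a) := by
  let L : (A ⧸ J) →ₗ[K] (A ⧸ J) :=
    (J.restrictScalars K).mapQ (J.restrictScalars K) (D : A →ₗ[K] A) hJ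
  have hL (a : A) : L (Ideal.Quotient.mk J a) = Ideal.Quotient.mk J (D a) := rfl
  refine ⟨Derivation.mk' L fun a b => ?_, hL⟩
  obtain ⟨a, rfl⟩ := Ideal.Quotient.mk_surjective a
  obtain ⟨b, rfl⟩ := Ideal.Quotient.mk_surjective b
  rw [← map_mul, hL, hL, hL, D.leibniz, map_add, smul_eq_mul, smul_eq_mul, map_mul, map_mul,
    smul_eq_mul, smul_eq_mul]

variable {K : Type*} [Field K] {n d : ℕ}

/-- Restriction of power series to the subspace `X_d = ⋯ = X_{n-1} = 0`: its kernel is generated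
by the equations of the subspace. -/
theorem ker_killCompl (h : d ≤ n) :
    RingHom.ker (killCompl (R := K) (Fin.castLEEmb h)) =
      Ideal.span {g | ∃ j : Fin n, d ≤ (j : ℕ) ∧ g = X j} := by
  classical
  refine le_antisymm (fun f hf => ?_) (Ideal.span_le.2 ?_)
  · obtain ⟨g, hg, -⟩ := exists_eq_sum_X_mul
      (Finset.univ.filter fun j : Fin n => d ≤ (j : ℕ)) f (by
        intro I hI
        have hI' : I = (I.comapDomain (Fin.castLEEmb h)
            (Fin.castLEEmb h).injective.injOn).embDomain (Fin.castLEEmb h) := by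
          refine (Finsupp.embDomain_comapDomain fun j hj => ?_).symm
          have hjd : (j : ℕ) < d := by
            by_contra hjd
            exact Finsupp.mem_support_iff.1 hj (hI j (by simpa using hjd))
          exact ⟨⟨j, hjd⟩, rfl⟩
        rw [hI', ← coeff_killCompl, RingHom.mem_ker.1 hf, map_zero])
    rw [hg]
    refine Ideal.sum_mem _ fun j hj => Ideal.mul_mem_right _ _ (Ideal.subset_span ⟨j, ?_, rfl⟩)
    simpa using hj
  · rintro _ ⟨j, hj, rfl⟩
    refine killCompl_X_eq_zero ?_
    rintro ⟨i, rfl⟩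
    exact absurd i.2 (not_lt.2 hj)

/-- The components of the automorphism of the formal affine space that straightens the graph of
the last components of `φ`. -/
noncomputable def graphAut (h : d ≤ n) (φ : Fin n → MvPowerSeries (Fin d) K) (j : Fin n) :
    MvPowerSeries (Fin n) K :=
  X j + if (j : ℕ) < d then 0 else rename (Fin.castLEEmb h) (φ j)

/-- A retraction `φ` of the formal affine space on a subspace of dimension `d` that respects the
first `d` coordinates is straightened by the automorphism `graphAut`. -/
theorem exists_algEquiv_graphAut (h : d ≤ n)
    (φ : MvPowerSeries (Fin n) K →ₐ[K] MvPowerSeries (Fin d) K)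
    (hφ : ∀ i : Fin d, φ (X (Fin.castLE h i)) = X i) :
    ∃ s : MvPowerSeries (Fin n) K ≃ₐ[K] MvPowerSeries (Fin n) K,
      (∀ j, s (X j) = graphAut h (fun j => φ (X j)) j) ∧
      (RingHom.ker φ).map (s : MvPowerSeries (Fin n) K →+* MvPowerSeries (Fin n) K) =
        Ideal.span {g | ∃ j : Fin n, d ≤ (j : ℕ) ∧ g = X j} := by
  let c : Fin n → MvPowerSeries (Fin n) K := fun j =>
    if (j : ℕ) < d then 0 else rename (Fin.castLEEmb h) (φ (X j))
  have hc0 (j : Fin n) : constantCoeff (c j) = 0 := by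
    simp only [c]
    split_ifs
    · simp
    · rw [constantCoeff_rename, constantCoeff_algHom, constantCoeff_X]
  have ha : HasSubst fun j => X j + c j :=
    hasSubst_of_constantCoeff_zero fun j => by simp [hc0]
  have hb : HasSubst fun j => X j - c j :=
    hasSubst_of_constantCoeff_zero fun j => by simp [hc0]
  -- Both substitutions fix the series in the first `d` variables.
  have fix (a : Fin n → MvPowerSeries (Fin n) K) (ha : HasSubst a)
      (ha' : ∀ j : Fin n, (j : ℕ) < d → a j = X j) (g : MvPowerSeries (Fin d) K) :
      substAlgHom (R := K) ha (rename (Fin.castLEEmb h) g) = rename (Fin.castLEEmb h) g := by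
    have : (substAlgHom (R := K) ha).comp (rename (Fin.castLEEmb h)) =
        rename (R := K) (Fin.castLEEmb h) := by
      refine algHom_ext_X fun i => ?_
      rw [AlgHom.comp_apply, rename_X, substAlgHom_X]
      exact ha' _ i.2
    exact DFunLike.congr_fun this g
  have fixc (a : Fin n → MvPowerSeries (Fin n) K) (ha : HasSubst a)
      (ha' : ∀ j : Fin n, (j : ℕ) < d → a j = X j) (j : Fin n) :
      substAlgHom (R := K) ha (c j) = c j := by
    simp only [c]
    split_ifs
    · exact map_zero _
    · exact fix a ha ha' _
  have ha' (j : Fin n) (hj : (j : ℕ) < d) : X j + c j = X j := by simp [c, hj]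
  have hb' (j : Fin n) (hj : (j : ℕ) < d) : X j - c j = X j := by simp [c, hj]
  let s : MvPowerSeries (Fin n) K ≃ₐ[K] MvPowerSeries (Fin n) K :=
    AlgEquiv.ofAlgHom (substAlgHom ha) (substAlgHom hb)
      (algHom_ext_X fun j => by
        rw [AlgHom.comp_apply, substAlgHom_X, map_sub, substAlgHom_X, fixc _ ha ha']
        simp)
      (algHom_ext_X fun j => by
        rw [AlgHom.comp_apply, substAlgHom_X, map_add, substAlgHom_X, fixc _ hb hb']
        simp)
  have hs (j : Fin n) : s (X j) = graphAut h (fun j => φ (X j)) j := substAlgHom_X ha j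
  refine ⟨s, hs, ?_⟩
  have hcomp : (killCompl (R := K) (Fin.castLEEmb h)).comp (s : _ →ₐ[K] _) = φ := by
    refine algHom_ext_X fun j => ?_
    rw [AlgHom.comp_apply, AlgEquiv.coe_toAlgHom, hs, graphAut, map_add]
    split_ifs with hj
    · have : X j = (X (Fin.castLEEmb h ⟨j, hj⟩) : MvPowerSeries (Fin n) K) := rfl
      rw [map_zero, add_zero, this, killCompl_X]
      exact (hφ ⟨j, hj⟩).symm
    · rw [killCompl_rename_app, killCompl_X_eq_zero, zero_add]
      rintro ⟨i, rfl⟩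
      exact hj i.2
  rw [← ker_killCompl h, ← hcomp]
  ext g
  rw [Ideal.mem_map_iff_of_surjective (s : MvPowerSeries (Fin n) K →+* MvPowerSeries (Fin n) K)
    (AlgEquiv.surjective s)]
  constructor
  · rintro ⟨f, hf, rfl⟩
    exact hf
  · intro hg
    refine ⟨s.symm g, ?_, s.apply_symm_apply g⟩
    rw [RingHom.mem_ker] at hg ⊢
    simpa using hg

/-- A derivation of a smooth formal subscheme that is compatible with a vector field `D` on the
coordinates is induced by `D`. -/
theorem derivation_quotient_eq (J : Ideal (MvPowerSeries (Fin n) K))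
    (e : (MvPowerSeries (Fin n) K ⧸ J) ≃ₐ[K] MvPowerSeries (Fin d) K)
    (D : Derivation K (MvPowerSeries (Fin n) K) (MvPowerSeries (Fin n) K))
    (E : Derivation K (MvPowerSeries (Fin n) K ⧸ J) (MvPowerSeries (Fin n) K ⧸ J))
    (h : ∀ j, E (Ideal.Quotient.mk J (X j)) = Ideal.Quotient.mk J (D (X j)))
    (f : MvPowerSeries (Fin n) K) :
    E (Ideal.Quotient.mk J f) = Ideal.Quotient.mk J (D f) := by
  let δ : Derivation K (MvPowerSeries (Fin n) K) (MvPowerSeries (Fin n) K ⧸ J) :=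
    E.compAlgebraMap (MvPowerSeries (Fin n) K) -
      (Submodule.mkQ J).compDer D
  have hδ : δ = 0 := by
    refine derivation_eq_zero δ (fun m hm => e.injective ?_) fun i => ?_
    · rw [map_zero]
      refine eq_zero_of_forall_mem_augIdeal_pow fun k => ?_
      refine Submodule.smul_induction_on (hm k) (fun a ha b _ => ?_) fun a b ha hb => ?_
      · have : a • b = Ideal.Quotient.mk J a * b := Algebra.smul_def a b
        rw [this, map_mul]
        exact Ideal.mul_mem_right _ _
          (algHom_mem_augIdeal_pow (e.toAlgHom.comp (Ideal.Quotient.mkₐ K J)) ha)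
      · rw [map_add]
        exact Ideal.add_mem _ ha hb
    · exact sub_eq_zero.2 (h i)
  exact sub_eq_zero.1 (DFunLike.congr_fun hδ f)

variable [CharZero K]

/-- The formal leaf through the origin of a commuting frame normalized by the first `d`
coordinates: it is given by the Taylor expansion along the frame. -/
theorem exists_formal_leaf (h : d ≤ n)
    (D : Fin d → Derivation K (MvPowerSeries (Fin n) K) (MvPowerSeries (Fin n) K))
    (hD : ∀ i j a, D i (D j a) = D j (D i a))
    (hDX : ∀ i j, D i (X (Fin.castLE h j)) = if i = j then 1 else 0) :
    ∃ φ : MvPowerSeries (Fin n) K →ₐ[K] MvPowerSeries (Fin d) K,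
      (∀ i a, φ (D i a) = pderiv K i (φ a)) ∧
      (∀ i, φ (X (Fin.castLE h i)) = X i) ∧ Function.Surjective φ := by
  let ev : MvPowerSeries (Fin n) K →ₐ[K] K :=
    { toRingHom := constantCoeff, commutes' := fun c => by simp [MvPowerSeries.algebraMap_apply] }
  obtain ⟨φ, hφ, hφ'⟩ := exists_taylor D hD ev
  have hX (i : Fin d) : φ (X (Fin.castLE h i)) = X i := by
    refine pderiv.ext (fun k => ?_) ?_
    · rw [← hφ', hDX, pderiv_X]
      by_cases hki : k = i
      · simp [hki]
      · simp [hki, Ne.symm hki]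
    · rw [hφ]
      change constantCoeff _ = _
      rw [constantCoeff_X, constantCoeff_X]
  refine ⟨φ, hφ', hX, fun g => ⟨rename (Fin.castLEEmb h) g, ?_⟩⟩
  have : φ.comp (rename (Fin.castLEEmb h)) = AlgHom.id K _ := by
    refine algHom_ext_X fun i => ?_
    rw [AlgHom.comp_apply, rename_X]
    exact hX i
  exact DFunLike.congr_fun this g

/-- A proper ideal stable under the frame is contained in the ideal of the leaf, and they are
equal if the quotients have the same dimension. -/
theorem eq_ker_of_stable
    {D : Fin d → Derivation K (MvPowerSeries (Fin n) K) (MvPowerSeries (Fin n) K)}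
    (φ : MvPowerSeries (Fin n) K →ₐ[K] MvPowerSeries (Fin d) K)
    (hφ : ∀ i a, φ (D i a) = pderiv K i (φ a)) (hsurj : Function.Surjective φ)
    (J : Ideal (MvPowerSeries (Fin n) K)) (hJ : ∀ i, ∀ f ∈ J, D i f ∈ J)
    (e : (MvPowerSeries (Fin n) K ⧸ J) ≃ₐ[K] MvPowerSeries (Fin d) K) :
    J = RingHom.ker φ := by
  have hJtop : J ≠ ⊤ := by
    rintro rfl
    have : Subsingleton (MvPowerSeries (Fin n) K ⧸ (⊤ : Ideal (MvPowerSeries (Fin n) K))) :=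
      Ideal.Quotient.subsingleton_iff.2 rfl
    exact not_subsingleton (MvPowerSeries (Fin d) K) e.symm.toEquiv.subsingleton
  have hle : J ≤ RingHom.ker φ := by
    intro f hf
    refine eq_zero_of_forall_word fun w => ?_
    rw [← map_iterWord φ hφ, constantCoeff_algHom]
    have hmem : iterWord (fun i => D i) w f ∈ J := by
      induction w with
      | nil => exact hf
      | cons i w ih => exact hJ i _ ih
    by_contra h0
    exact hJtop (Ideal.eq_top_of_isUnit_mem _ hmem
      (isUnit_iff_constantCoeff.2 (isUnit_iff_ne_zero.2 h0)))
  refine le_antisymm hle fun f hf => ?_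
  let χ : (MvPowerSeries (Fin n) K ⧸ J) →ₐ[K] MvPowerSeries (Fin d) K :=
    Ideal.Quotient.liftₐ J φ fun a ha => hle ha
  have hχ (a) : χ (Ideal.Quotient.mk J a) = φ a := rfl
  have hχs : Function.Surjective (χ.comp e.symm.toAlgHom) := by
    intro g
    obtain ⟨a, rfl⟩ := hsurj g
    exact ⟨e (Ideal.Quotient.mk J a), by simp [hχ]⟩
  have hinj := algHom_injective_of_surjective _ hχs
  refine Ideal.Quotient.eq_zero_iff_mem.1 (e.injective (hinj ?_))
  rw [map_zero, map_zero]
  simpa [hχ] using hf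

end Frobenius

/-! ### Growth of iterated polynomial vector fields -/

section Growth

open MvPolynomial

variable {K σ ι : Type*} [Field K]

/-- The sum of the absolute values of the coefficients of a polynomial. -/
noncomputable def coeffSum (v : AbsoluteValue K ℝ) (p : MvPolynomial σ K) : ℝ :=
  ∑ I ∈ p.support, v (p.coeff I)

variable (v : AbsoluteValue K ℝ)

theorem coeffSum_eq_of_subset (p : MvPolynomial σ K) {S : Finset (σ →₀ ℕ)} (h : p.support ⊆ S) :
    coeffSum v p = ∑ I ∈ S, v (p.coeff I) :=
  Finset.sum_subset h fun I _ hI => by rw [notMem_support_iff.1 hI, map_zero]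

theorem coeffSum_nonneg (p : MvPolynomial σ K) : 0 ≤ coeffSum v p :=
  Finset.sum_nonneg fun _ _ => v.nonneg _

theorem coeffSum_zero : coeffSum v (0 : MvPolynomial σ K) = 0 := by simp [coeffSum]

theorem coeff_le_coeffSum (p : MvPolynomial σ K) (I : σ →₀ ℕ) :
    v (p.coeff I) ≤ coeffSum v p := by
  by_cases h : I ∈ p.support
  · exact Finset.single_le_sum (f := fun I => v (p.coeff I)) (fun _ _ => v.nonneg _) h
  · rw [notMem_support_iff.1 h, map_zero]
    exact coeffSum_nonneg v p

theorem coeffSum_add_le (p q : MvPolynomial σ K) :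
    coeffSum v (p + q) ≤ coeffSum v p + coeffSum v q := by
  classical
  rw [coeffSum_eq_of_subset v (p + q) support_add,
    coeffSum_eq_of_subset v p Finset.subset_union_left,
    coeffSum_eq_of_subset v q Finset.subset_union_right, ← Finset.sum_add_distrib]
  exact Finset.sum_le_sum fun I _ => by rw [coeff_add]; exact v.add_le _ _

theorem coeffSum_sum_le {α : Type*} (S : Finset α) (p : α → MvPolynomial σ K) :
    coeffSum v (∑ i ∈ S, p i) ≤ ∑ i ∈ S, coeffSum v (p i) := by
  classical
  induction S using Finset.induction_on with
  | empty => simp [coeffSum_zero]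
  | insert i S hi ih =>
    rw [Finset.sum_insert hi, Finset.sum_insert hi]
    exact (coeffSum_add_le v _ _).trans (add_le_add_right ih _)

theorem coeffSum_monomial_le (I : σ →₀ ℕ) (a : K) : coeffSum v (monomial I a) ≤ v a := by
  classical
  rw [coeffSum_eq_of_subset v _ support_monomial_subset]
  simp

theorem coeffSum_mul_le (p q : MvPolynomial σ K) :
    coeffSum v (p * q) ≤ coeffSum v p * coeffSum v q := by
  have h : p * q = ∑ I ∈ p.support, ∑ J ∈ q.support,
      monomial (I + J) (p.coeff I * q.coeff J) := by
    conv_lhs => rw [p.as_sum, q.as_sum, Finset.sum_mul_sum]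
    simp only [monomial_mul]
  rw [h]
  refine (coeffSum_sum_le v _ _).trans ?_
  rw [coeffSum, coeffSum, Finset.sum_mul_sum]
  refine Finset.sum_le_sum fun I _ => (coeffSum_sum_le v _ _).trans ?_
  exact Finset.sum_le_sum fun J _ => (coeffSum_monomial_le v _ _).trans (v.map_mul _ _).le

theorem natCast_le_natCast (k : ℕ) : v (k : K) ≤ k := by
  induction k with
  | zero => simp
  | succ k ih =>
    push_cast
    refine (v.add_le _ _).trans ?_
    rw [v.map_one]
    linarith

theorem apply_le_totalDegree {p : MvPolynomial σ K} {I : σ →₀ ℕ} (hI : I ∈ p.support) (k : σ) :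
    I k ≤ p.totalDegree := by
  classical
  refine le_trans ?_ (le_totalDegree hI)
  by_cases hk : k ∈ I.support
  · exact Finset.single_le_sum (f := fun i => I i) (fun _ _ => Nat.zero_le _) hk
  · rw [Finsupp.notMem_support_iff.1 hk]
    exact Nat.zero_le _

theorem coeffSum_pderiv_le (k : σ) (p : MvPolynomial σ K) :
    coeffSum v (pderiv k p) ≤ p.totalDegree * coeffSum v p := by
  have h : pderiv k p = ∑ I ∈ p.support,
      monomial (I - Finsupp.single k 1) (p.coeff I * (I k : K)) := by
    conv_lhs => rw [p.as_sum, map_sum]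
    simp only [pderiv_monomial]
  rw [h]
  conv_rhs => rw [coeffSum, Finset.mul_sum]
  refine (coeffSum_sum_le v _ _).trans (Finset.sum_le_sum fun I hI => ?_)
  refine (coeffSum_monomial_le v _ _).trans ?_
  rw [v.map_mul, mul_comm]
  refine mul_le_mul_of_nonneg_right ?_ (v.nonneg _)
  exact (natCast_le_natCast v _).trans (by exact_mod_cast apply_le_totalDegree hI k)

theorem totalDegree_pderiv_le (k : σ) (p : MvPolynomial σ K) :
    (pderiv k p).totalDegree ≤ p.totalDegree := by
  classical
  refine Finset.sup_le fun I hI => ?_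
  have h : I + Finsupp.single k 1 ∈ p.support := by
    rw [mem_support_iff] at hI ⊢
    rw [coeff_pderiv] at hI
    exact left_ne_zero_of_mul hI
  refine le_trans ?_ (le_totalDegree h)
  rw [Finsupp.sum_add_index' (fun _ => rfl) (fun _ _ _ => rfl)]
  exact Nat.le_add_right _ _

variable [Fintype σ]

/-- A polynomial vector field is the combination `∑ D(X_k) ∂/∂X_k`. -/
theorem derivation_eq_sum_pderiv (D : Derivation K (MvPolynomial σ K) (MvPolynomial σ K))
    (p : MvPolynomial σ K) : D p = ∑ k, pderiv k p * D (X k) := by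
  classical
  let E : Derivation K (MvPolynomial σ K) (MvPolynomial σ K) := ∑ k, D (X k) • pderiv k
  have hE (p) : E p = ∑ k, pderiv k p * D (X k) := by
    have : E p = ∑ k, (D (X k) • pderiv k : Derivation K _ _) p := by
      simp only [E]
      rw [← Derivation.coeFnAddMonoidHom_apply, map_sum, Finset.sum_apply]
      rfl
    rw [this]
    exact Finset.sum_congr rfl fun k _ => mul_comm _ _
  have : D = E := derivation_ext fun i => by
    rw [hE]
    simp [pderiv_X, Pi.single_apply]
  rw [this, hE, ← this]

/-- Growth of the iterates of polynomial vector fields at an arbitrary absolute value: since the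
degree grows linearly, `k` applications multiply the sum of the absolute values of the coefficients
by at most `C ^ k * k!`. -/
theorem exists_bound_iterWord [Finite ι]
    (D : ι → Derivation K (MvPolynomial σ K) (MvPolynomial σ K)) (p : MvPolynomial σ K) :
    ∃ C : ℝ, ∀ w : List ι,
      v (constantCoeff (iterWord (fun i => D i) w p)) ≤ C * C ^ w.length * w.length.factorial := by
  classical
  have := Fintype.ofFinite ι
  let B : ℝ := ∑ i, ∑ k, coeffSum v (D i (X k))
  let δ : ℕ := ∑ i, ∑ k, (D i (X k)).totalDegree
  have hB0 : 0 ≤ B := Finset.sum_nonneg fun i _ => Finset.sum_nonneg fun k _ => coeffSum_nonneg v _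
  have hδ (i : ι) (k : σ) : (D i (X k)).totalDegree ≤ δ :=
    (Finset.single_le_sum (f := fun k => (D i (X k)).totalDegree)
      (fun _ _ => Nat.zero_le _) (Finset.mem_univ k)).trans
      (Finset.single_le_sum (f := fun i => ∑ k, (D i (X k)).totalDegree)
      (fun _ _ => Nat.zero_le _) (Finset.mem_univ i))
  have hB (i : ι) : ∑ k, coeffSum v (D i (X k)) ≤ B :=
    Finset.single_le_sum (f := fun i => ∑ k, coeffSum v (D i (X k)))
      (fun i _ => Finset.sum_nonneg fun k _ => coeffSum_nonneg v _) (Finset.mem_univ i)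
  let e := p.totalDegree
  have hdeg (w : List ι) : (iterWord (fun i => D i) w p).totalDegree ≤ e + w.length * δ := by
    induction w with
    | nil => simp [iterWord, e]
    | cons i w ih =>
      change (D i (iterWord (fun i => D i) w p)).totalDegree ≤ _
      rw [derivation_eq_sum_pderiv]
      refine (totalDegree_finsetSum _ _).trans (Finset.sup_le fun k _ => ?_)
      refine (totalDegree_mul _ _).trans ?_
      refine (add_le_add ((totalDegree_pderiv_le k _).trans ih) (hδ i k)).trans ?_
      rw [List.length_cons, add_mul, one_mul, add_assoc]
  let M : ℝ := B * (e + δ)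
  have hM0 : 0 ≤ M := mul_nonneg hB0 (by positivity)
  have hsum (w : List ι) : coeffSum v (iterWord (fun i => D i) w p) ≤
      coeffSum v p * M ^ w.length * w.length.factorial := by
    induction w with
    | nil => simp [iterWord]
    | cons i w ih =>
      change coeffSum v (D i (iterWord (fun i => D i) w p)) ≤ _
      set q := iterWord (fun i => D i) w p with hq
      have h1 : coeffSum v (D i q) ≤ q.totalDegree * coeffSum v q * B := by
        rw [derivation_eq_sum_pderiv]
        calc _ ≤ ∑ k, coeffSum v (pderiv k q * D i (X k)) := coeffSum_sum_le v _ _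
          _ ≤ ∑ k, q.totalDegree * coeffSum v q * coeffSum v (D i (X k)) :=
            Finset.sum_le_sum fun k _ => (coeffSum_mul_le v _ _).trans
              (mul_le_mul_of_nonneg_right (coeffSum_pderiv_le v k q) (coeffSum_nonneg v _))
          _ = q.totalDegree * coeffSum v q * ∑ k, coeffSum v (D i (X k)) := by
            rw [Finset.mul_sum]
          _ ≤ _ := mul_le_mul_of_nonneg_left (hB i)
            (mul_nonneg (Nat.cast_nonneg _) (coeffSum_nonneg v _))
      have h2 : (q.totalDegree : ℝ) ≤ (e + δ) * (w.length + 1) := by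
        have : (q.totalDegree : ℝ) ≤ e + w.length * δ := by exact_mod_cast hdeg w
        have h3 : (0 : ℝ) ≤ e * w.length := by positivity
        have h4 : (0 : ℝ) ≤ δ := by positivity
        linarith
      have h0 := coeffSum_nonneg v q
      calc coeffSum v (D i q) ≤ q.totalDegree * coeffSum v q * B := h1
        _ ≤ ((e + δ) * (w.length + 1)) *
            (coeffSum v p * M ^ w.length * w.length.factorial) * B := by gcongr
        _ = coeffSum v p * M ^ (i :: w).length * (i :: w).length.factorial := by
          rw [List.length_cons, Nat.factorial_succ]
          push_cast
          simp only [M]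
          ring
  refine ⟨coeffSum v p + M, fun w => ?_⟩
  have h1 : v (constantCoeff (iterWord (fun i => D i) w p)) ≤
      coeffSum v (iterWord (fun i => D i) w p) := by
    rw [constantCoeff_eq]
    exact coeff_le_coeffSum v _ _
  have h0 := coeffSum_nonneg v p
  refine h1.trans ((hsum w).trans ?_)
  gcongr <;> linarith

theorem apply_sum_le_of_nonarch (hv : IsNonarchimedean v) {α : Type*} (S : Finset α) (f : α → K)
    {M : ℝ} (hM : 0 ≤ M) (h : ∀ i ∈ S, v (f i) ≤ M) : v (∑ i ∈ S, f i) ≤ M := by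
  classical
  induction S using Finset.induction_on with
  | empty => simpa using hM
  | insert i S hi ih =>
    rw [Finset.sum_insert hi]
    exact (hv _ _).trans (max_le (h i (Finset.mem_insert_self i S))
      (ih fun j hj => h j (Finset.mem_insert_of_mem hj)))

/-- Growth of the iterates of polynomial vector fields at an ultrametric absolute value: partial
derivatives do not increase the absolute values of the coefficients. In particular, integral vector
fields (`B = 1`) preserve integrality. -/
theorem nonarch_iterWord_le (hv : IsNonarchimedean v)
    (D : ι → Derivation K (MvPolynomial σ K) (MvPolynomial σ K)) {B M : ℝ} (hB : 0 ≤ B)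
    (hD : ∀ i k I, v (coeff I (D i (X k))) ≤ B) (p : MvPolynomial σ K)
    (hp : ∀ I, v (coeff I p) ≤ M) (w : List ι) (I : σ →₀ ℕ) :
    v (coeff I (iterWord (fun i => D i) w p)) ≤ M * B ^ w.length := by
  classical
  have hM : 0 ≤ M := (v.nonneg _).trans (hp 0)
  induction w generalizing I with
  | nil => simpa [iterWord] using hp I
  | cons i w ih =>
    change v (coeff I (D i (iterWord (fun i => D i) w p))) ≤ _
    have h0 : 0 ≤ M * B ^ (i :: w).length := by positivity
    rw [derivation_eq_sum_pderiv, coeff_sum]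
    refine apply_sum_le_of_nonarch v hv _ _ h0 fun k _ => ?_
    rw [coeff_mul]
    refine apply_sum_le_of_nonarch v hv _ _ h0 fun J _ => ?_
    rw [v.map_mul, coeff_pderiv, v.map_mul, List.length_cons, pow_succ, ← mul_assoc]
    refine mul_le_mul ?_ (hD i k _) (v.nonneg _) (by positivity)
    have h1 : v ((J.1 k : K) + 1) ≤ 1 := by
      exact_mod_cast hv.apply_natCast_le_one (f := v) (n := J.1 k + 1)
    calc _ ≤ (M * B ^ w.length) * 1 :=
          mul_le_mul (ih _) h1 (v.nonneg _) (by positivity)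
      _ = _ := mul_one _

/-- At an ultrametric absolute value, the values at the origin of the iterated derivatives grow at
most exponentially. -/
theorem exists_bound_iterWord_of_nonarch [Finite ι] (hv : IsNonarchimedean v)
    (D : ι → Derivation K (MvPolynomial σ K) (MvPolynomial σ K)) (p : MvPolynomial σ K) :
    ∃ C : ℝ, ∀ w : List ι, v (constantCoeff (iterWord (fun i => D i) w p)) ≤ C * C ^ w.length := by
  classical
  have := Fintype.ofFinite ι
  let B : ℝ := ∑ i, ∑ k, coeffSum v (D i (X k))
  have hB0 : 0 ≤ B := Finset.sum_nonneg fun i _ => Finset.sum_nonneg fun k _ => coeffSum_nonneg v _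
  have hB (i : ι) (k : σ) (I : σ →₀ ℕ) : v (coeff I (D i (X k))) ≤ B :=
    (coeff_le_coeffSum v _ I).trans <|
    (Finset.single_le_sum (f := fun k => coeffSum v (D i (X k)))
      (fun _ _ => coeffSum_nonneg v _) (Finset.mem_univ k)).trans
    (Finset.single_le_sum (f := fun i => ∑ k, coeffSum v (D i (X k)))
      (fun i _ => Finset.sum_nonneg fun k _ => coeffSum_nonneg v _) (Finset.mem_univ i))
  have h0 := coeffSum_nonneg v p
  refine ⟨coeffSum v p + B, fun w => ?_⟩
  rw [constantCoeff_eq]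
  refine (nonarch_iterWord_le v hv D hB0 hB p (coeff_le_coeffSum v p) w 0).trans ?_
  gcongr <;> linarith

end Growth

/-- An ultrametric absolute value of a factorial is bounded below by an exponential: the least `q`
with `|q| < 1`, if there is one, is a prime number, and its exponent in `k!` is at most `k`. -/
theorem exists_pow_le_factorial {K : Type*} [Field K] [CharZero K] (v : AbsoluteValue K ℝ)
    (hv : IsNonarchimedean v) : ∃ c : ℝ, 0 < c ∧ ∀ k : ℕ, c ^ k ≤ v (k.factorial : K) := by
  by_cases h : ∃ q : ℕ, q ≠ 0 ∧ v (q : K) < 1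
  · classical
    obtain ⟨hq0, hq1⟩ := Nat.find_spec h
    set q := Nat.find h with hq
    have hmin (m : ℕ) (hm : m < q) (hm0 : m ≠ 0) : 1 ≤ v (m : K) := by
      by_contra hlt
      exact Nat.find_min h hm ⟨hm0, not_le.1 hlt⟩
    have hle (m : ℕ) : v (m : K) ≤ 1 := hv.apply_natCast_le_one
    have hprime : q.Prime := by
      have h2 : 2 ≤ q := by
        rcases Nat.lt_or_ge q 2 with hlt | hge
        · have : q = 1 := by omega
          rw [this] at hq1
          simp at hq1
        · exact hge
      by_contra hnp
      obtain ⟨a, ha, ha2, haq⟩ := Nat.exists_dvd_of_not_prime2 h2 hnp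
      obtain ⟨b, hb⟩ := ha
      have hb0 : b ≠ 0 := by rintro rfl; simp at hb; omega
      have hbq : b < q := by
        rw [hb]
        exact lt_mul_of_one_lt_left (Nat.pos_of_ne_zero hb0) (by omega)
      have h1 := hmin a haq (by omega)
      have h2 := hmin b hbq hb0
      rw [hb] at hq1
      push_cast at hq1
      rw [v.map_mul] at hq1
      nlinarith
    have hunit (m : ℕ) (hm : ¬ q ∣ m) : v (m : K) = 1 := by
      refine le_antisymm (hle m) (not_lt.1 fun hlt => ?_)
      have hco : Nat.Coprime q m := (Nat.Prime.coprime_iff_not_dvd hprime).2 hm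
      have hbez := Nat.gcd_eq_gcd_ab q m
      rw [hco] at hbez
      have hK : (1 : K) = q * (Nat.gcdA q m : K) + m * (Nat.gcdB q m : K) := by exact_mod_cast hbez
      have := hv (q * (Nat.gcdA q m : K)) (m * (Nat.gcdB q m : K))
      rw [← hK, v.map_one, v.map_mul, v.map_mul] at this
      have hz (z : ℤ) : v (z : K) ≤ 1 := hv.apply_intCast_le_one
      have h1 : v (q : K) * v (Nat.gcdA q m : K) < 1 :=
        (mul_le_of_le_one_right (v.nonneg _) (hz _)).trans_lt hq1
      have h2 : v (m : K) * v (Nat.gcdB q m : K) < 1 :=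
        (mul_le_of_le_one_right (v.nonneg _) (hz _)).trans_lt hlt
      exact absurd this (not_le.2 (max_lt h1 h2))
    have hpos : 0 < v (q : K) := v.pos (Nat.cast_ne_zero.2 hq0)
    refine ⟨v (q : K), hpos, fun k => ?_⟩
    have : Fact q.Prime := ⟨hprime⟩
    obtain ⟨u, hu⟩ : q ^ padicValNat q k.factorial ∣ k.factorial := pow_padicValNat_dvd
    have hqu : ¬ q ∣ u := by
      rintro ⟨t, rfl⟩
      refine pow_succ_padicValNat_not_dvd (p := q) (Nat.factorial_ne_zero k) ?_
      exact ⟨t, by rw [pow_succ, mul_assoc]; exact hu⟩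
    calc v (q : K) ^ k ≤ v (q : K) ^ padicValNat q k.factorial :=
          pow_le_pow_of_le_one hpos.le hq1.le (padicValNat_factorial_le _ k)
      _ = v (k.factorial : K) := by
        conv_rhs => rw [hu]
        push_cast
        rw [v.map_mul, v.map_pow, hunit u hqu, mul_one]
  · push Not at h
    exact ⟨1, one_pos, fun k => by simpa using h _ (Nat.factorial_ne_zero k)⟩

/-! ### Taylor coefficients along algebraic vector fields -/

section Arithmetic

/-- Vector fields on an affine variety of finite type, pointed by a rational point, lift to
polynomial vector fields on an affine space pointed by the origin. -/
theorem exists_polynomial_lift {K A : Type*} [Field K] [CommRing A] [Algebra K A]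
    [Algebra.FiniteType K A] {ι κ : Type*} (D : ι → Derivation K A A) (ev : A →ₐ[K] K)
    (x : κ → A) :
    ∃ (m : ℕ) (E : ι → Derivation K (MvPolynomial (Fin m) K) (MvPolynomial (Fin m) K))
      (p : κ → MvPolynomial (Fin m) K), ∀ j w,
      ev (iterWord (fun i => D i) w (x j)) =
        MvPolynomial.constantCoeff (iterWord (fun i => E i) w (p j)) := by
  obtain ⟨m, f, hf⟩ := Algebra.FiniteType.iff_quotient_mvPolynomial''.1
    (inferInstance : Algebra.FiniteType K A)
  -- generators of `A` that vanish at the rational point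
  let g : Fin m → A := fun k => f (.X k) - algebraMap K A (ev (f (.X k)))
  let π : MvPolynomial (Fin m) K →ₐ[K] A := MvPolynomial.aeval g
  have hπX (k : Fin m) : π (.X k) = g k := MvPolynomial.aeval_X _ _
  have hπ : Function.Surjective π := by
    intro a
    obtain ⟨p, rfl⟩ := hf a
    have : f = π.comp (MvPolynomial.aeval fun k =>
        MvPolynomial.X k + MvPolynomial.C (ev (f (.X k)))) := by
      ext k
      simp [hπX, g]
    exact ⟨_, (DFunLike.congr_fun this p).symm⟩
  have hev (p : MvPolynomial (Fin m) K) : ev (π p) = MvPolynomial.constantCoeff p := by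
    have : ((ev.comp π : _ →ₐ[K] K) : MvPolynomial (Fin m) K →+* K) =
        MvPolynomial.constantCoeff := by
      ext k
      · simp
      · simp [hπX, g]
    exact DFunLike.congr_fun this p
  choose q hq using fun (i : ι) (k : Fin m) => hπ (D i (g k))
  choose p hp using fun j => hπ (x j)
  let E : ι → Derivation K (MvPolynomial (Fin m) K) (MvPolynomial (Fin m) K) := fun i =>
    MvPolynomial.mkDerivation K (q i)
  have hE (i : ι) (r : MvPolynomial (Fin m) K) : π (E i r) = D i (π r) := by
    induction r using MvPolynomial.induction_on with
    | C a =>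
      rw [← MvPolynomial.algebraMap_eq, (E i).map_algebraMap, AlgHom.commutes,
        (D i).map_algebraMap, map_zero]
    | add r s hr hs => rw [map_add, map_add, map_add, map_add, hr, hs]
    | mul_X r k hr =>
      rw [(E i).leibniz, map_mul, (D i).leibniz, map_add, smul_eq_mul, smul_eq_mul, map_mul,
        map_mul, hr, smul_eq_mul, smul_eq_mul, hπX, MvPolynomial.mkDerivation_X, hq]
  refine ⟨m, E, p, fun j w => ?_⟩
  rw [← hev, map_iterWord (D := fun i => E i) (E := fun i => D i) π hE, hp]

open MvPowerSeries

variable {K : Type u} [Field K]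

theorem HasPosRadius.add {n : ℕ} {v : AbsoluteValue K ℝ} {f g : MvPowerSeries (Fin n) K}
    (hf : HasPosRadius v f) (hg : HasPosRadius v g) : HasPosRadius v (f + g) := by
  obtain ⟨r, hr, M, hM⟩ := hf
  obtain ⟨s, hs, N, hN⟩ := hg
  refine ⟨min r s, lt_min hr hs, M + N, fun I => ?_⟩
  have h0 : 0 ≤ min r s := (lt_min hr hs).le
  calc v (coeff I (f + g)) * min r s ^ I.degree
      ≤ (v (coeff I f) + v (coeff I g)) * min r s ^ I.degree := by
        rw [map_add]; exact mul_le_mul_of_nonneg_right (v.add_le _ _) (by positivity)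
    _ = v (coeff I f) * min r s ^ I.degree + v (coeff I g) * min r s ^ I.degree := add_mul _ _ _
    _ ≤ v (coeff I f) * r ^ I.degree + v (coeff I g) * s ^ I.degree := by
        have h1 := v.nonneg (coeff I f)
        have h2 := v.nonneg (coeff I g)
        gcongr
        · exact min_le_left _ _
        · exact min_le_right _ _
    _ ≤ M + N := add_le_add (hM I) (hN I)

theorem hasPosRadius_X {n : ℕ} (v : AbsoluteValue K ℝ) (j : Fin n) :
    HasPosRadius v (X j : MvPowerSeries (Fin n) K) := by
  classical
  refine ⟨1, one_pos, 1, fun I => ?_⟩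
  rw [coeff_X, one_pow, mul_one]
  split_ifs <;> simp

theorem hasPosRadius_zero {n : ℕ} (v : AbsoluteValue K ℝ) :
    HasPosRadius v (0 : MvPowerSeries (Fin n) K) :=
  ⟨1, one_pos, 0, fun I => by simp⟩

theorem HasPosRadius.rename {n d : ℕ} (e : Fin d ↪ Fin n) {v : AbsoluteValue K ℝ}
    {g : MvPowerSeries (Fin d) K} (hg : HasPosRadius v g) :
    HasPosRadius v (MvPowerSeries.rename e g) := by
  obtain ⟨r, hr, M, hM⟩ := hg
  refine ⟨r, hr, max M 0, fun I => ?_⟩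
  by_cases hI : I ∈ Set.range (Finsupp.embDomain (M := ℕ) e)
  · obtain ⟨I, rfl⟩ := hI
    rw [coeff_embDomain_rename]
    have : (I.embDomain e).degree = I.degree := by
      rw [Finsupp.degree_eq_sum, Finsupp.degree_eq_sum]
      refine (Fintype.sum_of_injective e e.injective _ _ (fun j hj => ?_) fun i => ?_).symm
      · exact Finsupp.embDomain_of_notMem_range e I j hj
      · exact (Finsupp.embDomain_apply_self e I i).symm
    rw [this]
    exact (hM I).trans (le_max_left _ _)
  · rw [coeff_rename_eq_zero, map_zero, zero_mul]
    · exact le_max_right _ _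
    · rintro ⟨J, hJ⟩
      exact hI ⟨J, by rw [Finsupp.embDomain_eq_mapDomain, hJ]⟩

theorem multiFactorial_embDomain {n d : ℕ} (e : Fin d ↪ Fin n) (I : Fin d →₀ ℕ) :
    multiFactorial (I.embDomain e) = multiFactorial I := by
  refine (Fintype.prod_of_injective e e.injective _ _ (fun j hj => ?_) fun i => ?_).symm
  · rw [Finsupp.embDomain_of_notMem_range e I j hj, Nat.factorial_zero]
  · rw [Finsupp.embDomain_apply_self e I i]

theorem coeff_single_rename_castLE {n d : ℕ} (h : d ≤ n) (g : MvPowerSeries (Fin d) K)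
    {j : Fin n} (hj : d ≤ (j : ℕ)) :
    coeff (Finsupp.single j 1) (MvPowerSeries.rename (Fin.castLEEmb h) g) = 0 := by
  refine coeff_rename_eq_zero _ _ ?_
  rintro ⟨J, hJ⟩
  have h1 : (J.mapDomain (Fin.castLEEmb h)) j = 0 := by
    refine Finsupp.mapDomain_of_notMem_range _ _ ?_
    rintro ⟨i, rfl⟩
    exact absurd i.2 (not_lt.2 hj)
  rw [hJ] at h1
  simp at h1

/-- The Jacobian matrix of `graphAut` at the origin is lower triangular, with ones on the
diagonal. -/
theorem graphAut_isFormalAut {n d : ℕ} (h : d ≤ n) (g : Fin n → MvPowerSeries (Fin d) K)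
    (hg : ∀ j, constantCoeff (g j) = 0) : IsFormalAut (graphAut h g) := by
  classical
  have hcoeff (i j : Fin n) (hij : i ≤ j) :
      coeff (Finsupp.single j 1) (graphAut h g i) = if i = j then 1 else 0 := by
    have h0 : coeff (Finsupp.single j 1)
        (if (i : ℕ) < d then 0 else MvPowerSeries.rename (Fin.castLEEmb h) (g i)) = 0 := by
      split_ifs with hi
      · rfl
      · exact coeff_single_rename_castLE h _ ((not_lt.1 hi).trans hij)
    rw [graphAut, map_add, h0, add_zero, coeff_X]
    simp [Finsupp.single_left_inj one_ne_zero, eq_comm]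
  refine ⟨fun j => ?_, ?_⟩
  · rw [graphAut, map_add, constantCoeff_X, zero_add]
    split_ifs
    · simp
    · rw [constantCoeff_rename, hg]
  · rw [Matrix.det_of_isLowerTriangular]
    · simp [hcoeff]
    · intro i j hij
      have hij : i < j := hij
      simp [hcoeff i j hij.le, hij.ne]

/-- Comparison of `|I|!` and `I!`: the multinomial coefficients grow at most exponentially. -/
theorem factorial_degree_le {d : ℕ} (I : Fin d →₀ ℕ) :
    I.degree.factorial ≤ (2 ^ d) ^ I.degree * multiFactorial I := by
  classical
  have key (s : Finset (Fin d)) : (∑ i ∈ s, I i).factorial ≤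
      (2 ^ s.card) ^ (∑ i ∈ s, I i) * ∏ i ∈ s, (I i).factorial := by
    induction s using Finset.induction_on with
    | empty => simp
    | insert a s ha ih =>
      rw [Finset.sum_insert ha, Finset.prod_insert ha, Finset.card_insert_of_notMem ha]
      set S := ∑ i ∈ s, I i
      calc (I a + S).factorial
          = (I a + S).choose S * (I a).factorial * S.factorial :=
            (Nat.add_choose_mul_factorial_mul_factorial (I a) S).symm
        _ ≤ 2 ^ (I a + S) * (I a).factorial *
            ((2 ^ s.card) ^ S * ∏ i ∈ s, (I i).factorial) := by
            gcongr
            exact Nat.choose_le_two_pow _ _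
        _ ≤ 2 ^ (I a + S) * (I a).factorial *
            ((2 ^ s.card) ^ (I a + S) * ∏ i ∈ s, (I i).factorial) := by
            gcongr
            · exact Nat.one_le_two_pow
            · exact Nat.le_add_left _ _
        _ = _ := by rw [pow_succ 2 s.card, mul_pow]; ring
  have := key Finset.univ
  rwa [← Finsupp.degree_eq_sum, Finset.card_univ, Fintype.card_fin] at this

/-- Convergence at an Archimedean place: a growth of `I! g_I` like `|I|!` is harmless. -/
theorem hasPosRadius_of_factorial_le {d : ℕ} (v : AbsoluteValue K ℝ) (g : MvPowerSeries (Fin d) K)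
    (hnat : ∀ k : ℕ, v (k : K) = k) {C : ℝ}
    (hC : ∀ I : Fin d →₀ ℕ, v (multiFactorial I * coeff I g) ≤
      C * C ^ I.degree * I.degree.factorial) : HasPosRadius v g := by
  have hC0 : 0 ≤ C := by simpa using (v.nonneg _).trans (hC 0)
  refine ⟨(C * 2 ^ d + 1)⁻¹, by positivity, C, fun I => ?_⟩
  have hI : (0 : ℝ) < multiFactorial I := by
    exact_mod_cast Nat.pos_of_ne_zero (multiFactorial_ne_zero I)
  have h1 : v (coeff I g) ≤ C * (C * 2 ^ d) ^ I.degree := by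
    refine le_of_mul_le_mul_left ?_ hI
    have h2 := hC I
    rw [v.map_mul, hnat] at h2
    have h3 : (I.degree.factorial : ℝ) ≤ (2 ^ d) ^ I.degree * multiFactorial I := by
      exact_mod_cast factorial_degree_le I
    calc _ ≤ C * C ^ I.degree * ((2 ^ d) ^ I.degree * multiFactorial I) :=
          h2.trans (by gcongr)
      _ = _ := by rw [mul_pow]; ring
  calc _ ≤ C * (C * 2 ^ d) ^ I.degree * (C * 2 ^ d + 1)⁻¹ ^ I.degree := by gcongr
    _ = C * ((C * 2 ^ d) * (C * 2 ^ d + 1)⁻¹) ^ I.degree := by rw [mul_pow _ (_⁻¹)]; ring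
    _ ≤ C * 1 := by
      gcongr
      refine pow_le_one₀ (by positivity) ?_
      rw [← div_eq_mul_inv]
      exact div_le_one_of_le₀ (by linarith) (by positivity)
    _ = C := mul_one C

/-- Convergence at an ultrametric place, where `1 / |I!|` grows at most exponentially. -/
theorem hasPosRadius_of_nonarch [CharZero K] {d : ℕ} (v : AbsoluteValue K ℝ)
    (hv : IsNonarchimedean v) (g : MvPowerSeries (Fin d) K) {C : ℝ}
    (hC : ∀ I : Fin d →₀ ℕ, v (multiFactorial I * coeff I g) ≤ C * C ^ I.degree) :
    HasPosRadius v g := by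
  have hC0 : 0 ≤ C := by simpa using (v.nonneg _).trans (hC 0)
  obtain ⟨c, hc, hc'⟩ := exists_pow_le_factorial v hv
  have hfac (I : Fin d →₀ ℕ) : c ^ I.degree ≤ v (multiFactorial I : K) := by
    rw [multiFactorial, Nat.cast_prod, map_prod, Finsupp.degree_eq_sum,
      ← Finset.prod_pow_eq_pow_sum]
    exact Finset.prod_le_prod (fun _ _ => by positivity) fun i _ => hc' _
  refine ⟨c * (C + 1)⁻¹, by positivity, C, fun I => ?_⟩
  have h2 := hC I
  rw [v.map_mul] at h2
  have h0 := v.nonneg (coeff I g)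
  calc v (coeff I g) * (c * (C + 1)⁻¹) ^ I.degree
      = (c ^ I.degree * v (coeff I g)) * (C + 1)⁻¹ ^ I.degree := by rw [mul_pow]; ring
    _ ≤ (v (multiFactorial I : K) * v (coeff I g)) * (C + 1)⁻¹ ^ I.degree := by
        have := hfac I
        gcongr
    _ ≤ (C * C ^ I.degree) * (C + 1)⁻¹ ^ I.degree := by gcongr
    _ = C * (C * (C + 1)⁻¹) ^ I.degree := by rw [mul_pow]; ring
    _ ≤ C * 1 := by
      gcongr
      refine pow_le_one₀ (by positivity) ?_
      rw [← div_eq_mul_inv]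
      exact div_le_one_of_le₀ (by linarith) (by positivity)
    _ = C := mul_one C

theorem HasPosRadius.graphAut {n d : ℕ} (h : d ≤ n) {g : Fin n → MvPowerSeries (Fin d) K}
    (v : AbsoluteValue K ℝ) (hg : ∀ j, HasPosRadius v (g j)) (j : Fin n) :
    HasPosRadius v (graphAut h g j) := by
  refine (hasPosRadius_X v j).add ?_
  split_ifs
  · exact hasPosRadius_zero v
  · exact (hg j).rename _

variable [NumberField K]

/-- An element of a number field is integral at almost all places. -/
theorem finite_setOf_one_lt_finiteAbs (x : K) :
    {p : IsDedekindDomain.HeightOneSpectrum (𝓞 K) | 1 < finiteAbs p x}.Finite := by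
  refine (IsDedekindDomain.HeightOneSpectrum.Support.finite (𝓞 K) x).subset fun p hp => ?_
  by_contra hle
  have hle : p.valuation K x ≤ 1 := not_lt.1 hle
  have hp : 1 < finiteAbs p x := hp
  refine absurd hp (not_lt.2 ?_)
  rw [finiteAbs, NumberField.HeightOneSpectrum.adicAbv_def]
  exact_mod_cast (WithZeroMulInt.toNNReal_le_one_iff
    (NumberField.HeightOneSpectrum.one_lt_absNorm_nnreal p)).2 hle

/-- The graph of the Taylor expansions, along algebraic vector fields, of regular functions on a
variety of finite type over a number field is straightened by an automorphism in `G_{an,1}`: the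
derivatives at a rational point are integral at almost all places, and dividing by the
factorials gives the bound. -/
theorem isGanOfType_graphAut {n d : ℕ} (h : d ≤ n) {g : Fin n → MvPowerSeries (Fin d) K}
    (hg : ∀ j, constantCoeff (g j) = 0) {A : Type*} [CommRing A] [Algebra K A]
    [Algebra.FiniteType K A] (D : Fin d → Derivation K A A) (ev : A →ₐ[K] K) (x : Fin n → A)
    (hx : ∀ (j : Fin n) (I : Fin d →₀ ℕ), ∃ w : List (Fin d), w.length = I.degree ∧
      (multiFactorial I : K) * coeff I (g j) = ev (iterWord (fun i => D i) w (x j))) :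
    IsGanOfType 1 (graphAut h g) := by
  classical
  obtain ⟨m, E, p, hE⟩ := exists_polynomial_lift D ev x
  refine ⟨⟨graphAut_isFormalAut h g hg, fun q => ?_, fun s => ?_⟩, ?_⟩
  · refine HasPosRadius.graphAut h (finiteAbs q) fun j => ?_
    have hv := NumberField.HeightOneSpectrum.isNonarchimedean_adicAbv K q
    obtain ⟨C, hC⟩ := exists_bound_iterWord_of_nonarch (finiteAbs q) hv E (p j)
    refine hasPosRadius_of_nonarch (finiteAbs q) hv (g j) (C := C) fun I => ?_
    obtain ⟨w, hw, hw'⟩ := hx j I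
    rw [hw', ← hw, hE]
    exact hC w
  · let v : AbsoluteValue K ℝ := (NormedField.toAbsoluteValue ℂ).comp s.injective
    refine HasPosRadius.graphAut h v fun j => ?_
    obtain ⟨C, hC⟩ := exists_bound_iterWord v E (p j)
    refine hasPosRadius_of_factorial_le v (g j) (fun k => ?_) (C := C) fun I => ?_
    · change ‖s k‖ = k
      simp
    · obtain ⟨w, hw, hw'⟩ := hx j I
      rw [hw', ← hw, hE]
      exact hC w
  -- Outside `S₁ ∪ S₂` the coefficients of the lifted vector fields and functions are integral, so
  -- that the constants `C_q = 1` are suitable.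
  · let S₁ : Set (IsDedekindDomain.HeightOneSpectrum (𝓞 K)) :=
      ⋃ i, ⋃ k, ⋃ I ∈ (E i (.X k)).support, {q | 1 < finiteAbs q ((E i (.X k)).coeff I)}
    let S₂ : Set (IsDedekindDomain.HeightOneSpectrum (𝓞 K)) :=
      ⋃ j, ⋃ I ∈ (p j).support, {q | 1 < finiteAbs q ((p j).coeff I)}
    have hS₁ : S₁.Finite := Set.finite_iUnion fun i => Set.finite_iUnion fun k =>
      Set.Finite.biUnion (Finset.finite_toSet _) fun I _ => finite_setOf_one_lt_finiteAbs _
    have hS₂ : S₂.Finite := Set.finite_iUnion fun j =>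
      Set.Finite.biUnion (Finset.finite_toSet _) fun I _ => finite_setOf_one_lt_finiteAbs _
    refine ⟨(hS₁.union hS₂).toFinset, fun _ => 1, fun _ => le_rfl, multipliable_one, ?_⟩
    rintro ⟨q, hq⟩ j I
    have hq' : q ∉ S₁ ∪ S₂ := by simpa using hq
    have hv := NumberField.HeightOneSpectrum.isNonarchimedean_adicAbv K q
    have h1 (i : Fin d) (k : Fin m) (I) : finiteAbs q ((E i (.X k)).coeff I) ≤ 1 := by
      by_contra hlt
      refine hq' (Or.inl ?_)
      simp only [S₁, Set.mem_iUnion]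
      refine ⟨i, k, I, ?_, not_le.1 hlt⟩
      rw [MvPolynomial.mem_support_iff]
      intro h0
      simp [h0] at hlt
    have h2 (I) : finiteAbs q ((p j).coeff I) ≤ 1 := by
      by_contra hlt
      refine hq' (Or.inr ?_)
      simp only [S₂, Set.mem_iUnion]
      refine ⟨j, I, ?_, not_le.1 hlt⟩
      rw [MvPolynomial.mem_support_iff]
      intro h0
      simp [h0] at hlt
    have hfacle (I : Fin n →₀ ℕ) : finiteAbs q (multiFactorial I : K) ≤ 1 :=
      NumberField.HeightOneSpectrum.adicAbv_natCast_le_one K q _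
    have hfacpos {r : ℕ} (I : Fin r →₀ ℕ) : 0 < finiteAbs q (multiFactorial I : K) :=
      (finiteAbs q).pos (Nat.cast_ne_zero.2 (multiFactorial_ne_zero I))
    rw [one_pow, NNReal.coe_one, Real.rpow_one, le_div_iff₀ (hfacpos I)]
    rw [graphAut, map_add]
    have hX : finiteAbs q (coeff I (X j : MvPowerSeries (Fin n) K)) *
        finiteAbs q (multiFactorial I : K) ≤ 1 := by
      refine mul_le_one₀ ?_ (hfacpos I).le (hfacle I)
      rw [coeff_X]
      split_ifs <;> simp
    have hR : finiteAbs q (coeff I (if (j : ℕ) < d then 0 else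
        MvPowerSeries.rename (Fin.castLEEmb h) (g j))) *
          finiteAbs q (multiFactorial I : K) ≤ 1 := by
      split_ifs
      · simp
      by_cases hI : I ∈ Set.range (Finsupp.embDomain (M := ℕ) (Fin.castLEEmb h))
      · obtain ⟨I, rfl⟩ := hI
        rw [coeff_embDomain_rename, multiFactorial_embDomain, mul_comm, ← map_mul]
        obtain ⟨w, hw, hw'⟩ := hx j I
        rw [hw', hE, MvPolynomial.constantCoeff_eq]
        simpa using nonarch_iterWord_le (finiteAbs q) hv E zero_le_one h1 (p j) h2 w 0
      · rw [coeff_rename_eq_zero, map_zero, zero_mul]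
        · exact zero_le_one
        · rintro ⟨J, hJ⟩
          exact hI ⟨J, by rw [Finsupp.embDomain_eq_mapDomain, hJ]⟩
    refine le_trans (mul_le_mul_of_nonneg_right (hv _ _) (hfacpos I).le) ?_
    rw [max_mul_of_nonneg _ _ (hfacpos I).le]
    exact max_le hX hR

end Arithmetic

/-! ### Vector fields in étale coordinates -/

section Etale

open scoped TensorProduct

section Derivations

variable {K A B M : Type*} [CommRing K] [CommRing A] [CommRing B] [Algebra K B] [Algebra A B]

/-- Derivations of an unramified algebra `B` over `A` are determined by their restrictions
to `A`. -/
theorem derivation_ext_of_formallyUnramified [Algebra.FormallyUnramified A B] [AddCommGroup M]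
    [Module B M] [Module K M] [IsScalarTower K B M] {D E : Derivation K B M}
    (h : ∀ a : A, D (algebraMap A B a) = E (algebraMap A B a)) : D = E := by
  let : Module A M := Module.compHom M (algebraMap A B)
  have : IsScalarTower A B M := ⟨fun a b m => by
    rw [Algebra.smul_def, mul_smul]; rfl⟩
  let δ : Derivation A B M := Derivation.mk'
    { toFun := fun b => (D - E) b
      map_add' := fun b c => map_add (D - E) b c
      map_smul' := fun a b => by
        rw [Algebra.smul_def, (D - E).leibniz, RingHom.id_apply]
        have : (D - E) (algebraMap A B a) = 0 := sub_eq_zero.2 (h a)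
        rw [this, smul_zero, add_zero]
        rfl } fun b c => (D - E).leibniz b c
  have hδ : δ = 0 := by
    have : Subsingleton (Derivation A B M) :=
      (KaehlerDifferential.linearMapEquivDerivation A B).symm.toEquiv.subsingleton
    exact Subsingleton.elim _ _
  ext b
  exact sub_eq_zero.1 (DFunLike.congr_fun hδ b)

/-- Derivations extend along formally étale homomorphisms. -/
theorem exists_derivation_extension [Algebra K A] [IsScalarTower K A B] [Algebra.FormallyEtale A B]
    (D : Derivation K A B) :
    ∃ E : Derivation K B B, ∀ a, E (algebraMap A B a) = D a := by
  let l : B ⊗[A] Ω[A⁄K] →ₗ[B] B := LinearMap.liftBaseChange B D.liftKaehlerDifferential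
  let e := KaehlerDifferential.tensorKaehlerEquivOfFormallyEtale K A B
  refine ⟨(l ∘ₗ e.symm.toLinearMap).compDer (KaehlerDifferential.D K B), fun a => ?_⟩
  change l (e.symm (KaehlerDifferential.D K B (algebraMap A B a))) = D a
  rw [KaehlerDifferential.tensorKaehlerEquivOfFormallyEtale_symm_D_algebraMap]
  simp [l]

end Derivations

variable {K A : Type*} [Field K] [CommRing A] [Algebra K A] {n : ℕ} {x : Fin n → A}

/-- Vector fields are determined by the derivatives of étale coordinates. -/
theorem derivation_ext_of_etale (hx : (MvPolynomial.aeval (R := K) x).toRingHom.FormallyEtale)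
    {M : Type*} [AddCommGroup M] [Module A M] [Module K M] [IsScalarTower K A M]
    {D E : Derivation K A M} (h : ∀ j, D (x j) = E (x j)) : D = E := by
  let := (MvPolynomial.aeval (R := K) x).toRingHom.toAlgebra
  have : Algebra.FormallyEtale (MvPolynomial (Fin n) K) A := hx
  have : IsScalarTower K (MvPolynomial (Fin n) K) A :=
    IsScalarTower.of_algebraMap_eq' (MvPolynomial.aeval (R := K) x).comp_algebraMap.symm
  refine derivation_ext_of_formallyUnramified (A := MvPolynomial (Fin n) K) fun p => ?_
  change D (MvPolynomial.aeval x p) = E (MvPolynomial.aeval x p)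
  induction p using MvPolynomial.induction_on with
  | C a => rw [MvPolynomial.aeval_C, D.map_algebraMap, E.map_algebraMap]
  | add p q hp hq => rw [map_add, map_add, map_add, hp, hq]
  | mul_X p i hp => rw [map_mul, D.leibniz, E.leibniz, hp, MvPolynomial.aeval_X, h]

/-- The coordinate vector fields of étale coordinates. -/
theorem exists_partial (hx : (MvPolynomial.aeval (R := K) x).toRingHom.FormallyEtale) :
    ∃ D : Fin n → Derivation K A A, ∀ i j, D i (x j) = if i = j then 1 else 0 := by
  classical
  let := (MvPolynomial.aeval (R := K) x).toRingHom.toAlgebra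
  have : Algebra.FormallyEtale (MvPolynomial (Fin n) K) A := hx
  have : IsScalarTower K (MvPolynomial (Fin n) K) A :=
    IsScalarTower.of_algebraMap_eq' (MvPolynomial.aeval (R := K) x).comp_algebraMap.symm
  choose D hD using fun i : Fin n => exists_derivation_extension
    (MvPolynomial.mkDerivation K fun j : Fin n => if i = j then (1 : A) else 0)
  refine ⟨D, fun i j => ?_⟩
  have hxj : x j = algebraMap (MvPolynomial (Fin n) K) A (.X j) :=
    (MvPolynomial.aeval_X x j).symm
  rw [hxj, hD, MvPolynomial.mkDerivation_X]

theorem derivation_sum_smul_apply {ι M : Type*} [AddCommGroup M] [Module A M] [Module K M]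
    [IsScalarTower K A M] [Fintype ι]
    (a : ι → A) (D : ι → Derivation K A M) (f : A) :
    (∑ i, a i • D i) f = ∑ i, a i • D i f := by
  rw [← Derivation.coeFnAddMonoidHom_apply, map_sum, Finset.sum_apply]
  rfl

open MvPowerSeries

/-- The vector field on the formal affine space with given components. -/
noncomputable def formalField (g : Fin n → MvPowerSeries (Fin n) K) :
    Derivation K (MvPowerSeries (Fin n) K) (MvPowerSeries (Fin n) K) :=
  ∑ j, g j • pderiv K j

theorem formalField_apply (g : Fin n → MvPowerSeries (Fin n) K) (f) :
    formalField g f = ∑ j, g j * pderiv K j f :=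
  derivation_sum_smul_apply _ _ _

theorem formalField_X (g : Fin n → MvPowerSeries (Fin n) K) (j : Fin n) :
    formalField g (X j) = g j := by
  classical
  rw [formalField_apply]
  simp [pderiv_X, Pi.single_apply]

/-- Taylor expansion in étale coordinates, that is to say along the coordinate vector fields, which
commute: every vector field becomes the vector field on the formal affine space whose components
are the expansions of the derivatives of the coordinates. -/
theorem exists_etale_taylor [CharZero K]
    (hx : (MvPolynomial.aeval (R := K) x).toRingHom.FormallyEtale)
    (ev : A →ₐ[K] K) (hev : ∀ j, ev (x j) = 0) :
    ∃ T : A →ₐ[K] MvPowerSeries (Fin n) K, (∀ j, T (x j) = X j) ∧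
      (∀ a, constantCoeff (T a) = ev a) ∧
      ∀ (D : Derivation K A A) (a : A), T (D a) = formalField (fun j => T (D (x j))) (T a) := by
  classical
  obtain ⟨D, hD⟩ := exists_partial hx
  have hcomm (i j : Fin n) (a : A) : D i (D j a) = D j (D i a) := by
    have : ⁅D i, D j⁆ = 0 := derivation_ext_of_etale hx fun k => by
      rw [Derivation.commutator_apply, hD, hD]
      split_ifs <;> simp
    have := DFunLike.congr_fun this a
    rwa [Derivation.commutator_apply, Derivation.zero_apply, sub_eq_zero] at this
  obtain ⟨T, hT, hT'⟩ := exists_taylor D hcomm ev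
  refine ⟨T, fun j => pderiv.ext (fun k => ?_) ?_, hT, fun E a => ?_⟩
  · rw [← hT', hD, pderiv_X]
    by_cases hkj : k = j
    · simp [hkj]
    · simp [hkj, Ne.symm hkj]
  · rw [hT, hev, constantCoeff_X]
  · have hE : E = ∑ j, E (x j) • D j := derivation_ext_of_etale hx fun k => by
      rw [derivation_sum_smul_apply]
      simp [hD]
    conv_lhs => rw [hE, derivation_sum_smul_apply]
    rw [map_sum, formalField_apply]
    exact Finset.sum_congr rfl fun j _ => by rw [smul_eq_mul, map_mul, hT']

end Etale

/-! ### The complete local ring in étale coordinates -/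

section Completion

open MvPowerSeries

variable {K R : Type*} [Field K] {n : ℕ} [CommRing R] [IsLocalRing R] [Algebra K R] {y : Fin n → R}

theorem mem_maximalIdeal_iff_of_algHom (ev : R →ₐ[K] K) (r : R) :
    r ∈ IsLocalRing.maximalIdeal R ↔ ev r = 0 := by
  have hmax : (RingHom.ker (ev : R →+* K)).IsMaximal :=
    RingHom.ker_isMaximal_of_surjective _ fun c => ⟨algebraMap K R c, ev.commutes c⟩
  rw [← IsLocalRing.eq_maximalIdeal hmax]
  rfl

theorem sub_algebraMap_mem_maximalIdeal (ev : R →ₐ[K] K) (r : R) :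
    r - algebraMap K R (ev r) ∈ IsLocalRing.maximalIdeal R := by
  rw [mem_maximalIdeal_iff_of_algHom ev, map_sub, AlgHom.commutes]
  simp

/-- Étale coordinates at a rational point generate its maximal ideal: the class of `r - r(P)`
modulo the ideal generated by the coordinates and the square of the maximal ideal is a derivation of
`r` that kills the coordinates, so it vanishes, and Nakayama's lemma applies. -/
theorem maximalIdeal_eq_span (hy : (MvPolynomial.aeval (R := K) y).toRingHom.FormallyEtale)
    [IsNoetherianRing R] (ev : R →ₐ[K] K) (hev : ∀ j, ev (y j) = 0) :
    IsLocalRing.maximalIdeal R = Ideal.span (Set.range y) := by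
  set m := IsLocalRing.maximalIdeal R with hm
  set I := Ideal.span (Set.range y) with hI
  have hIm : I ≤ m := Ideal.span_le.2 (by
    rintro _ ⟨j, rfl⟩
    exact (mem_maximalIdeal_iff_of_algHom ev _).2 (hev j))
  let J := I ⊔ m * m
  let L : R →ₗ[K] R ⧸ J :=
    (Ideal.Quotient.mkₐ K J).toLinearMap ∘ₗ
      (LinearMap.id - (Algebra.linearMap K R) ∘ₗ ev.toLinearMap)
  have hL (r : R) : L r = Ideal.Quotient.mk J (r - algebraMap K R (ev r)) := rfl
  let δ : Derivation K R (R ⧸ J) := Derivation.mk' L fun a b => by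
    have ha : a • L b = Ideal.Quotient.mk J (a * (b - algebraMap K R (ev b))) := rfl
    have hb : b • L a = Ideal.Quotient.mk J (b * (a - algebraMap K R (ev a))) := rfl
    rw [ha, hb, hL, ← map_add, Ideal.Quotient.eq, map_mul, map_mul]
    have : a * b - algebraMap K R (ev a) * algebraMap K R (ev b) -
        (a * (b - algebraMap K R (ev b)) + b * (a - algebraMap K R (ev a))) =
        -((a - algebraMap K R (ev a)) * (b - algebraMap K R (ev b))) := by ring
    rw [this]
    exact Ideal.mem_sup_right (neg_mem (Ideal.mul_mem_mul
      (sub_algebraMap_mem_maximalIdeal ev a) (sub_algebraMap_mem_maximalIdeal ev b)))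
  have hδ : δ = 0 := derivation_ext_of_etale hy fun j => by
    change L (y j) = 0
    rw [hL, hev, map_zero, sub_zero, Ideal.Quotient.eq_zero_iff_mem]
    exact Ideal.mem_sup_left (Ideal.subset_span ⟨j, rfl⟩)
  refine le_antisymm ?_ hIm
  refine Submodule.le_of_le_smul_of_le_jacobson_bot (I := m) (IsNoetherian.noetherian m)
    (IsLocalRing.maximalIdeal_le_jacobson ⊥) fun r hr => ?_
  have h1 : Ideal.Quotient.mk J (r - algebraMap K R (ev r)) = 0 := DFunLike.congr_fun hδ r
  rw [(mem_maximalIdeal_iff_of_algHom ev r).1 hr, map_zero, sub_zero,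
    Ideal.Quotient.eq_zero_iff_mem] at h1
  exact h1

/-- Polynomials in the coordinates are dense in the local ring. -/
theorem exists_aeval_sub_mem (ev : R →ₐ[K] K)
    (hy : IsLocalRing.maximalIdeal R = Ideal.span (Set.range y)) (r : R) (k : ℕ) :
    ∃ p : MvPolynomial (Fin n) K,
      r - MvPolynomial.aeval y p ∈ IsLocalRing.maximalIdeal R ^ k := by
  induction k generalizing r with
  | zero => exact ⟨0, by simp⟩
  | succ k ih =>
    have h1 := sub_algebraMap_mem_maximalIdeal ev r
    rw [hy, Ideal.mem_span_range_iff_exists_fun] at h1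
    obtain ⟨c, hc⟩ := h1
    choose p hp using fun j => ih (c j)
    refine ⟨MvPolynomial.C (ev r) + ∑ j, p j * MvPolynomial.X j, ?_⟩
    have : r - MvPolynomial.aeval y (MvPolynomial.C (ev r) + ∑ j, p j * MvPolynomial.X j) =
        ∑ j, (c j - MvPolynomial.aeval y (p j)) * y j := by
      simp only [map_add, MvPolynomial.aeval_C, map_sum, map_mul, MvPolynomial.aeval_X,
        sub_mul, Finset.sum_sub_distrib]
      rw [hc]
      ring
    rw [this, pow_succ]
    refine Ideal.sum_mem _ fun j _ => Ideal.mul_mem_mul (hp j) ?_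
    rw [hy]
    exact Ideal.subset_span ⟨j, rfl⟩

/-- A local ring with residue field `K` whose maximal ideal is generated by `y_1, …, y_n`, and
with a local homomorphism to the power series that sends `y_j` to `X_j`, has the ring of power
series for completion. -/
theorem exists_completion_algEquiv (ev : R →ₐ[K] K)
    (hy : IsLocalRing.maximalIdeal R = Ideal.span (Set.range y))
    (T : R →ₐ[K] MvPowerSeries (Fin n) K) (hT : ∀ j, T (y j) = X j)
    (hTev : ∀ r, constantCoeff (T r) = ev r) :
    ∃ θ : AdicCompletion (IsLocalRing.maximalIdeal R) R ≃ₐ[K] MvPowerSeries (Fin n) K,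
      ∀ r, θ (algebraMap R _ r) = T r := by
  set m := IsLocalRing.maximalIdeal R with hm
  have hle {k : ℕ} {r : R} (hr : r ∈ m ^ k) : T r ∈ augIdeal (Fin n) K ^ k := by
    have h : (m ^ k).map (T : R →+* MvPowerSeries (Fin n) K) ≤ augIdeal (Fin n) K ^ k := by
      rw [Ideal.map_pow]
      refine Ideal.pow_right_mono (Ideal.map_le_iff_le_comap.2 fun g hg => ?_) k
      exact (hTev g).trans ((mem_maximalIdeal_iff_of_algHom ev g).1 hg)
    exact h (Ideal.mem_map_of_mem _ hr)
  have hTp (p : MvPolynomial (Fin n) K) : T (MvPolynomial.aeval y p) = p := by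
    have : T.comp (MvPolynomial.aeval y) = MvPolynomial.coeToMvPowerSeries.algHom K := by
      ext j
      simp [hT]
    simpa using DFunLike.congr_fun this p
  have hge {k : ℕ} {r : R} (hr : T r ∈ augIdeal (Fin n) K ^ k) : r ∈ m ^ k := by
    obtain ⟨p, hp⟩ := exists_aeval_sub_mem ev hy r k
    have h1 : (p : MvPowerSeries (Fin n) K) ∈ augIdeal (Fin n) K ^ k := by
      have : (p : MvPowerSeries (Fin n) K) = T r - T (r - MvPolynomial.aeval y p) := by
        rw [map_sub, hTp]; ring
      rw [this]
      exact Ideal.sub_mem _ hr (hle hp)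
    have h2 : MvPolynomial.aeval y p ∈ m ^ k := by
      rw [MvPolynomial.aeval_def, MvPolynomial.eval₂_eq]
      refine Ideal.sum_mem _ fun I hI => Ideal.mul_mem_left _ _ ?_
      have hI' : k ≤ I.degree := by
        by_contra hlt
        have := mem_augIdeal_pow.1 h1 I (not_le.1 hlt)
        rw [MvPolynomial.coeff_coe] at this
        exact MvPolynomial.mem_support_iff.1 hI this
      refine Ideal.pow_le_pow_right hI' ?_
      rw [Finsupp.degree_apply, ← Finset.prod_pow_eq_pow_sum]
      exact Ideal.prod_mem_prod fun j _ =>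
        Ideal.pow_mem_pow (hy.ge (Ideal.subset_span ⟨j, rfl⟩)) _
    have := Ideal.add_mem _ hp h2
    rwa [sub_add_cancel] at this
  let E (k : ℕ) : (R ⧸ m ^ k) →ₐ[K] (MvPowerSeries (Fin n) K ⧸ augIdeal (Fin n) K ^ k) :=
    Ideal.quotientMapₐ _ T fun r hr => hle hr
  have hE (k : ℕ) (r : R) : E k (Ideal.Quotient.mk _ r) = Ideal.Quotient.mk _ (T r) := rfl
  have hEbij (k : ℕ) : Function.Bijective (E k) := by
    constructor
    · rw [injective_iff_map_eq_zero]
      intro r hr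
      obtain ⟨r, rfl⟩ := Ideal.Quotient.mk_surjective r
      rw [hE, Ideal.Quotient.eq_zero_iff_mem] at hr
      exact Ideal.Quotient.eq_zero_iff_mem.2 (hge hr)
    · intro b
      obtain ⟨b, rfl⟩ := Ideal.Quotient.mk_surjective b
      obtain ⟨p, hp⟩ := exists_polynomial_sub_mem b k
      refine ⟨Ideal.Quotient.mk _ (MvPolynomial.aeval y p), ?_⟩
      rw [hE, hTp]
      exact (Ideal.Quotient.eq.2 hp).symm
  let e (k : ℕ) := AlgEquiv.ofBijective (E k) (hEbij k)
  have he {k : ℕ} {r : R} {b : MvPowerSeries (Fin n) K}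
      (h : b - T r ∈ augIdeal (Fin n) K ^ k) :
      (e k).symm (Ideal.Quotient.mk _ b) = Ideal.Quotient.mk _ r := by
    rw [AlgEquiv.symm_apply_eq]
    exact Ideal.Quotient.eq.2 h
  have hdense (b : MvPowerSeries (Fin n) K) (k : ℕ) :
      ∃ r, b - T r ∈ augIdeal (Fin n) K ^ k := by
    obtain ⟨p, hp⟩ := exists_polynomial_sub_mem b k
    exact ⟨MvPolynomial.aeval y p, by rwa [hTp]⟩
  let f (k : ℕ) : MvPowerSeries (Fin n) K →ₐ[K] R ⧸ m ^ k :=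
    (e k).symm.toAlgHom.comp (Ideal.Quotient.mkₐ K _)
  have hf (k : ℕ) (b) : f k b = (e k).symm (Ideal.Quotient.mk _ b) := rfl
  have hfc {j k : ℕ} (hjk : j ≤ k) :
      (Ideal.Quotient.factorₐ K (Ideal.pow_le_pow_right hjk)).comp (f k) = f j := by
    ext b
    obtain ⟨r, hr⟩ := hdense b k
    rw [AlgHom.comp_apply, hf, hf, he hr, he (Ideal.pow_le_pow_right hjk hr)]
    rfl
  let ψ : MvPowerSeries (Fin n) K →ₐ[K] AdicCompletion m R := AdicCompletion.liftAlgHom m f hfc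
  have hψ (k : ℕ) (b) : AdicCompletion.evalₐ m k (ψ b) = f k b :=
    AdicCompletion.evalₐ_liftAlgHom m f hfc k b
  have hψbij : Function.Bijective ψ := by
    constructor
    · rw [injective_iff_map_eq_zero]
      intro b hb
      refine eq_zero_of_forall_mem_augIdeal_pow fun k => ?_
      have h1 := hψ k b
      rw [hb, map_zero, hf, eq_comm, EmbeddingLike.map_eq_zero_iff,
        Ideal.Quotient.eq_zero_iff_mem] at h1
      exact h1
    · intro z
      obtain ⟨r, rfl⟩ := AdicCompletion.mk_surjective m R z
      have hr' {j k : ℕ} (hjk : j ≤ k) : r j - r k ∈ m ^ j :=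
        Ideal.Quotient.eq.1 (AdicCompletion.Ideal.mk_eq_mk m hjk r).symm
      let b : MvPowerSeries (Fin n) K := fun I => coeff I (T (r (I.degree + 1)))
      have hb (k : ℕ) : b - T (r k) ∈ augIdeal (Fin n) K ^ k := by
        refine mem_augIdeal_pow.2 fun I hI => ?_
        have h1 := mem_augIdeal_pow.1 (hle (hr' hI)) I (Nat.lt_succ_self _)
        rw [map_sub, map_sub] at h1
        rw [map_sub]
        exact h1
      refine ⟨b, AdicCompletion.ext_evalₐ fun k => ?_⟩
      rw [hψ, hf, he (hb k), AdicCompletion.evalₐ_mk]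
  refine ⟨(AlgEquiv.ofBijective ψ hψbij).symm, fun r => ?_⟩
  rw [AlgEquiv.symm_apply_eq]
  refine AdicCompletion.ext_evalₐ fun k => ?_
  rw [AlgEquiv.ofBijective_apply, hψ, hf, he (r := r) (by simp), AlgHom.commutes]
  rfl

/-- The complete local ring at a rational point with étale coordinates is the ring of power
series in these coordinates, and vector fields expand accordingly. -/
theorem exists_etale_completion [CharZero K] [IsNoetherianRing R]
    (hy : (MvPolynomial.aeval (R := K) y).toRingHom.FormallyEtale) (ev : R →ₐ[K] K)
    (hev : ∀ j, ev (y j) = 0) :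
    ∃ θ : AdicCompletion (IsLocalRing.maximalIdeal R) R ≃ₐ[K] MvPowerSeries (Fin n) K,
      (∀ j, θ (algebraMap R _ (y j)) = X j) ∧
      (∀ r, constantCoeff (θ (algebraMap R _ r)) = ev r) ∧
      ∀ (D : Derivation K R R) (r : R), θ (algebraMap R _ (D r)) =
        formalField (fun j => θ (algebraMap R _ (D (y j)))) (θ (algebraMap R _ r)) := by
  obtain ⟨T, hTy, hTev, hTD⟩ := exists_etale_taylor hy ev hev
  obtain ⟨θ, hθ⟩ := exists_completion_algEquiv ev (maximalIdeal_eq_span hy ev hev) T hTy hTev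
  refine ⟨θ, fun j => by rw [hθ, hTy], fun r => by rw [hθ, hTev], fun D r => ?_⟩
  simp only [hθ]
  exact hTD D r

end Completion

/-! ### Involutive families of vector fields on a local ring -/

section LinearAlgebra

variable {K : Type*} [Field K] {d n : ℕ}

/-- A matrix with independent rows has an invertible maximal minor, which may be moved to the
first columns. -/
theorem exists_perm_isUnit_minor (M : Matrix (Fin d) (Fin n) K)
    (hM : ∀ c : Fin d → K, (∀ j, ∑ i, c i * M i j = 0) → c = 0) :
    ∃ (h : d ≤ n) (σ : Equiv.Perm (Fin n)),
      IsUnit (M.submatrix id fun j : Fin d => σ (Fin.castLE h j)) := by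
  classical
  have hrow : LinearIndependent K M.row := Fintype.linearIndependent_iff.2 fun c hc i => by
    refine congrFun (hM c fun j => ?_) i
    have := congrFun hc j
    simpa [Finset.sum_apply] using this
  have hrank : M.rank = d := by simpa using hrow.rank_matrix
  obtain ⟨κ, a, ha, hspan, hli⟩ := exists_linearIndependent' K M.col
  have : Finite κ := Finite.of_injective a ha
  have : Fintype κ := Fintype.ofFinite κ
  have hcard : Fintype.card κ = d := by
    rw [← finrank_span_eq_card hli, hspan, ← Matrix.rank_eq_finrank_span_cols, hrank]
  let e : Fin d ≃ κ := (Fintype.equivFinOfCardEq hcard).symm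
  have hf : Function.Injective (a ∘ e) := ha.comp e.injective
  have h : d ≤ n := by simpa using Fintype.card_le_of_injective _ hf
  obtain ⟨σ, hσ⟩ := (Equiv.Perm.isMultiplyPretransitive (Fin n) d).exists_smul_eq
    (Fin.castLEEmb h) ⟨a ∘ e, hf⟩
  have hσ' (j : Fin d) : σ (Fin.castLE h j) = a (e j) := DFunLike.congr_fun hσ j
  refine ⟨h, σ, ?_⟩
  simp only [hσ']
  rw [← Matrix.linearIndependent_cols_iff_isUnit]
  exact hli.comp e e.injective

end LinearAlgebra

section Frame

theorem mem_map_algEquiv {K A B : Type*} [CommRing K] [CommRing A] [CommRing B] [Algebra K A]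
    [Algebra K B] (θ : A ≃ₐ[K] B) (J : Ideal A) (b : B) :
    b ∈ J.map (θ : A →+* B) ↔ θ.symm b ∈ J := by
  rw [Ideal.mem_map_iff_of_surjective (θ : A →+* B) θ.surjective]
  constructor
  · rintro ⟨a, ha, rfl⟩
    change θ.symm (θ a) ∈ J
    rwa [θ.symm_apply_apply]
  · exact fun hb => ⟨_, hb, θ.apply_symm_apply b⟩

variable {K R : Type*} [Field K] [CommRing R] [IsLocalRing R] [Algebra K R] {d n : ℕ}

/-- An involutive family of vector fields that are independent at the rational point is spanned,
after a permutation of the coordinates, by commuting vector fields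
`∂/∂y_i + ∑_{j > d} a_ij ∂/∂y_j` with `i ≤ d`. -/
theorem exists_commuting_frame (y : Fin n → R) (ev : R →ₐ[K] K)
    (D : Fin d → Derivation K R R)
    (hlie : ∀ i j, ⁅D i, D j⁆ ∈ Submodule.span R (Set.range D))
    (hind : ∀ c : Fin d → K, (∀ j, ∑ i, c i * ev (D i (y j)) = 0) → c = 0) :
    ∃ (h : d ≤ n) (σ : Equiv.Perm (Fin n)) (E : Fin d → Derivation K R R),
      Submodule.span R (Set.range E) = Submodule.span R (Set.range D) ∧
      (∀ i j, E i (y (σ (Fin.castLE h j))) = if i = j then 1 else 0) ∧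
      ∀ i j a, E i (E j a) = E j (E i a) := by
  classical
  obtain ⟨h, σ, hσ⟩ := exists_perm_isUnit_minor (Matrix.of fun i j => ev (D i (y j))) hind
  let A : Matrix (Fin d) (Fin d) R := Matrix.of fun i j => D i (y (σ (Fin.castLE h j)))
  have hA : IsUnit A.det := by
    have h1 : (ev : R →+* K).mapMatrix A =
        (Matrix.of fun i j => ev (D i (y j))).submatrix id
          fun j : Fin d => σ (Fin.castLE h j) := rfl
    rw [← h1, Matrix.isUnit_iff_isUnit_det, ← RingHom.map_det] at hσ
    by_contra hnu
    exact hσ.ne_zero ((mem_maximalIdeal_iff_of_algHom ev _).1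
      ((IsLocalRing.mem_maximalIdeal _).2 hnu))
  let E : Fin d → Derivation K R R := fun i => ∑ k, A⁻¹ i k • D k
  have hE (i : Fin d) (r : R) : E i r = ∑ k, A⁻¹ i k * D k r :=
    derivation_sum_smul_apply _ _ _
  have hEy (i j : Fin d) : E i (y (σ (Fin.castLE h j))) = if i = j then 1 else 0 := by
    have h1 : E i (y (σ (Fin.castLE h j))) = (A⁻¹ * A) i j := by
      rw [hE, Matrix.mul_apply]
      rfl
    rw [h1, Matrix.nonsing_inv_mul A hA, Matrix.one_apply]
  have hspan : Submodule.span R (Set.range E) = Submodule.span R (Set.range D) := by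
    refine le_antisymm (Submodule.span_le.2 ?_) (Submodule.span_le.2 ?_)
    · rintro _ ⟨i, rfl⟩
      exact Submodule.sum_mem _ fun k _ =>
        Submodule.smul_mem _ _ (Submodule.subset_span ⟨k, rfl⟩)
    · rintro _ ⟨i, rfl⟩
      have h1 : D i = ∑ k, A i k • E k := by
        ext r
        rw [derivation_sum_smul_apply]
        simp only [hE, smul_eq_mul, Finset.mul_sum]
        rw [Finset.sum_comm]
        simp only [← mul_assoc, ← Finset.sum_mul]
        have h2 (l : Fin d) : ∑ k, A i k * A⁻¹ k l = if i = l then 1 else 0 := by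
          rw [← Matrix.mul_apply, Matrix.mul_nonsing_inv A hA, Matrix.one_apply]
        simp [h2]
      rw [h1]
      exact Submodule.sum_mem _ fun k _ =>
        Submodule.smul_mem _ _ (Submodule.subset_span ⟨k, rfl⟩)
  have hbr (i j : Fin d) : ⁅E i, E j⁆ ∈ Submodule.span R (Set.range E) := by
    have hsmul (r s : R) (X Y : Derivation K R R) :
        ⁅r • X, s • Y⁆ = (r * s) • ⁅X, Y⁆ + (r * X s) • Y - (s * Y r) • X := by
      ext a
      simp only [Derivation.commutator_apply, Derivation.coe_smul, Pi.smul_apply, smul_eq_mul,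
        Derivation.coe_sub, Derivation.coe_add, Pi.sub_apply, Pi.add_apply, Derivation.leibniz]
      ring
    have hmem (k : Fin d) : D k ∈ Submodule.span R (Set.range D) :=
      Submodule.subset_span ⟨k, rfl⟩
    rw [hspan]
    change ⁅∑ k, A⁻¹ i k • D k, ∑ l, A⁻¹ j l • D l⁆ ∈ _
    rw [sum_lie_sum]
    refine Submodule.sum_mem _ fun k _ => Submodule.sum_mem _ fun l _ => ?_
    rw [hsmul]
    exact Submodule.sub_mem _ (Submodule.add_mem _ (Submodule.smul_mem _ _ (hlie k l))
      (Submodule.smul_mem _ _ (hmem l))) (Submodule.smul_mem _ _ (hmem k))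
  refine ⟨h, σ, E, hspan, hEy, fun i j a => ?_⟩
  -- the bracket is a combination of the `E k` and kills the first `d` coordinates
  obtain ⟨c, hc⟩ := (Submodule.mem_span_range_iff_exists_fun R).1 (hbr i j)
  have hc0 (l : Fin d) : c l = 0 := by
    have h1 : (∑ k, c k • E k) (y (σ (Fin.castLE h l))) = c l := by
      rw [derivation_sum_smul_apply]
      simp [hEy]
    rw [← h1, hc, Derivation.commutator_apply, hEy, hEy]
    split_ifs <;> simp
  have h0 : ⁅E i, E j⁆ = 0 := by
    rw [← hc]
    simp [hc0]
  have := DFunLike.congr_fun h0 a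
  rwa [Derivation.commutator_apply, Derivation.zero_apply, sub_eq_zero] at this

open MvPowerSeries

variable [CharZero K] [IsNoetherianRing R] {y : Fin n → R}

/-- The formal Frobenius theorem at a rational point with étale coordinates `y`, for commuting
vector fields `D_i` with `D_i y_j = δ_ij` for `j ≤ d`: the leaf is the graph of power series
`g_j`, the Taylor expansions of `y_j` along the `D_i`. -/
theorem exists_unique_leaf (hy : (MvPolynomial.aeval (R := K) y).toRingHom.FormallyEtale)
    (ev : R →ₐ[K] K) (hev : ∀ j, ev (y j) = 0) (h : d ≤ n) (D : Fin d → Derivation K R R)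
    (hDy : ∀ i j, D i (y (Fin.castLE h j)) = if i = j then 1 else 0)
    (hcomm : ∀ i j a, D i (D j a) = D j (D i a)) :
    ∃ (J₀ : Ideal (AdicCompletion (IsLocalRing.maximalIdeal R) R))
      (g : Fin n → MvPowerSeries (Fin d) K),
      Nonempty ((AdicCompletion (IsLocalRing.maximalIdeal R) R ⧸ J₀) ≃ₐ[K]
        MvPowerSeries (Fin d) K) ∧
      (∀ i, ∃ E : Derivation K (AdicCompletion (IsLocalRing.maximalIdeal R) R ⧸ J₀)
          (AdicCompletion (IsLocalRing.maximalIdeal R) R ⧸ J₀),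
        ∀ r, E (Ideal.Quotient.mk J₀ (algebraMap R _ r)) =
          Ideal.Quotient.mk J₀ (algebraMap R _ (D i r))) ∧
      (∀ J : Ideal (AdicCompletion (IsLocalRing.maximalIdeal R) R),
        Nonempty ((AdicCompletion (IsLocalRing.maximalIdeal R) R ⧸ J) ≃ₐ[K]
          MvPowerSeries (Fin d) K) →
        (∀ i, ∃ E : Derivation K (AdicCompletion (IsLocalRing.maximalIdeal R) R ⧸ J)
            (AdicCompletion (IsLocalRing.maximalIdeal R) R ⧸ J),
          ∀ r, E (Ideal.Quotient.mk J (algebraMap R _ r)) =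
            Ideal.Quotient.mk J (algebraMap R _ (D i r))) → J = J₀) ∧
      (∀ j, constantCoeff (g j) = 0) ∧
      (∀ j I, ∃ w : List (Fin d), w.length = I.degree ∧
        (multiFactorial I : K) * coeff I (g j) = ev (iterWord (fun i => D i) w (y j))) ∧
      ∃ θ : AdicCompletion (IsLocalRing.maximalIdeal R) R ≃ₐ[K] MvPowerSeries (Fin n) K,
        (∀ j, θ (algebraMap R _ (y j)) = graphAut h g j) ∧
        J₀.map (θ : AdicCompletion (IsLocalRing.maximalIdeal R) R →+* MvPowerSeries (Fin n) K) =
          Ideal.span {f | ∃ j : Fin n, d ≤ (j : ℕ) ∧ f = X j} := by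
  classical
  obtain ⟨θ, hθy, hθev, hθD⟩ := exists_etale_completion hy ev hev
  set O := AdicCompletion (IsLocalRing.maximalIdeal R) R with hO
  let g (i : Fin d) (j : Fin n) : MvPowerSeries (Fin n) K := θ (algebraMap R O (D i (y j)))
  let Dh (i : Fin d) := formalField (g i)
  have hDhX (i : Fin d) (j : Fin n) : Dh i (X j) = θ (algebraMap R O (D i (y j))) :=
    formalField_X _ _
  have hDh (i : Fin d) (r : R) : Dh i (θ (algebraMap R O r)) = θ (algebraMap R O (D i r)) :=
    (hθD (D i) r).symm
  have hDhcomm (i j : Fin d) (a) : Dh i (Dh j a) = Dh j (Dh i a) := by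
    have h0 : ⁅Dh i, Dh j⁆ = 0 := by
      refine derivation_eq_zero _ (fun m hm => ?_) fun k => ?_
      · exact eq_zero_of_forall_mem_augIdeal_pow fun k => by simpa using hm k
      · rw [Derivation.commutator_apply, hDhX, hDhX, hDh, hDh, hcomm, sub_self]
    have := DFunLike.congr_fun h0 a
    rwa [Derivation.commutator_apply, Derivation.zero_apply, sub_eq_zero] at this
  obtain ⟨φ, hφD, hφX, hφs⟩ := exists_formal_leaf h Dh hDhcomm fun i j => by
    rw [hDhX, hDy]
    split_ifs <;> simp
  let J₀ : Ideal O := RingHom.ker (φ.comp θ.toAlgHom)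
  have hJ₀ (z : O) : z ∈ J₀ ↔ φ (θ z) = 0 := Iff.rfl
  let Ψ : O →ₐ[K] MvPowerSeries (Fin d) K := φ.comp θ.toAlgHom
  obtain ⟨s, hs, hsJ⟩ := exists_algEquiv_graphAut h φ hφX
  have hmap : J₀.map (θ : O →+* MvPowerSeries (Fin n) K) = RingHom.ker φ := by
    ext b
    rw [mem_map_algEquiv, hJ₀, θ.apply_symm_apply]
    rfl
  refine ⟨J₀, fun j => φ (X j), ⟨Ideal.quotientKerAlgEquivOfSurjective (f := Ψ)
    (hφs.comp θ.surjective)⟩, fun i => ?_, fun J ⟨e⟩ hJ => ?_, fun j => ?_, fun j I => ?_,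
    θ.trans s, fun j => ?_, ?_⟩
  · let Δ : Derivation K O O := Derivation.mk'
      (θ.symm.toLinearMap ∘ₗ (Dh i : _ →ₗ[K] _) ∘ₗ θ.toLinearMap) fun a b => by
        refine θ.injective ?_
        simp [Derivation.leibniz]
    have hΔ (z : O) : θ (Δ z) = Dh i (θ z) := θ.apply_symm_apply _
    obtain ⟨E, hE⟩ := exists_derivation_quotient Δ J₀ fun z hz => by
      rw [hJ₀] at hz ⊢
      rw [hΔ, hφD, hz, map_zero]
    refine ⟨E, fun r => ?_⟩
    rw [hE]
    congr 1
    exact θ.injective (by rw [hΔ, hDh])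
  · set J' := J.map (θ : O →+* MvPowerSeries (Fin n) K) with hJ'
    have hJ'mem (z : O) : θ z ∈ J' ↔ z ∈ J := by
      rw [hJ', mem_map_algEquiv, θ.symm_apply_apply]
    let τ : (O ⧸ J) ≃ₐ[K] (MvPowerSeries (Fin n) K ⧸ J') := Ideal.quotientEquivAlg J J' θ rfl
    have hτ (z : O) : τ (Ideal.Quotient.mk J z) = Ideal.Quotient.mk J' (θ z) := rfl
    have hτ' (b : MvPowerSeries (Fin n) K) :
        τ.symm (Ideal.Quotient.mk J' b) = Ideal.Quotient.mk J (θ.symm b) := by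
      rw [AlgEquiv.symm_apply_eq, hτ, θ.apply_symm_apply]
    have hstable (i : Fin d) (f) (hf : f ∈ J') : Dh i f ∈ J' := by
      obtain ⟨E, hE⟩ := hJ i
      let E' : Derivation K (MvPowerSeries (Fin n) K ⧸ J') (MvPowerSeries (Fin n) K ⧸ J') :=
        Derivation.mk' (τ.toLinearMap ∘ₗ (E : _ →ₗ[K] _) ∘ₗ τ.symm.toLinearMap) fun a b => by
          simp [Derivation.leibniz]
      have hE'τ (b) : E' b = τ (E (τ.symm b)) := rfl
      have hE' := derivation_quotient_eq J' (τ.symm.trans e) (Dh i) E' (fun j => by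
        rw [hE'τ, hτ', ← hθy, θ.symm_apply_apply, hE, hτ, hDh]) f
      rw [← Ideal.Quotient.eq_zero_iff_mem, ← hE', Ideal.Quotient.eq_zero_iff_mem.2 hf, map_zero]
    have hker := eq_ker_of_stable φ hφD hφs J' hstable (τ.symm.trans e)
    ext z
    rw [← hJ'mem, hker, hJ₀]
    rfl
  · rw [constantCoeff_algHom, constantCoeff_X]
  · obtain ⟨w, hw, hwI⟩ := exists_word_constantCoeff (K := K) I
    refine ⟨w, hw, ?_⟩
    rw [← hwI, ← map_iterWord (D := fun i => Dh i) φ hφD, constantCoeff_algHom, ← hθy,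
      ← map_iterWord (D := fun i => D i) (fun r => θ (algebraMap R O r)) fun i r =>
        (hDh i r).symm, hθev]
  · rw [AlgEquiv.trans_apply, hθy, hs]
  · have : ((θ.trans s : O ≃ₐ[K] MvPowerSeries (Fin n) K) : O →+* MvPowerSeries (Fin n) K) =
        (s : MvPowerSeries (Fin n) K →+* MvPowerSeries (Fin n) K).comp
          (θ : O →+* MvPowerSeries (Fin n) K) := rfl
    rw [this, ← Ideal.map_map, hmap, hsJ]

end Frame

section FiniteType

variable {K A R : Type*} [Field K] [CommRing A] [Algebra K A] [CommRing R] [Algebra K R]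
  [Algebra A R] [IsScalarTower K A R] {d n : ℕ}

/-- Finitely many vector fields on a localization of an algebra of finite type are defined over
a subalgebra of finite type. -/
theorem exists_stable_subalgebra [Algebra.FiniteType K A] (S : Submonoid A) [IsLocalization S R]
    (D : Fin d → Derivation K R R) :
    ∃ B : Subalgebra K R, B.FG ∧ (∀ a, algebraMap A R a ∈ B) ∧ ∀ i, ∀ r ∈ B, D i r ∈ B := by
  obtain ⟨t, ht⟩ := (‹Algebra.FiniteType K A›).out
  obtain ⟨s, hs⟩ := IsLocalization.exist_integer_multiples_of_finite S
    fun p : Fin d × t => D p.1 (algebraMap A R p.2)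
  let u : R := IsLocalization.mk' R 1 s
  have hu : algebraMap A R s * u = 1 := by
    rw [mul_comm, IsLocalization.mk'_spec, map_one]
  let B : Subalgebra K R := Algebra.adjoin K (insert u (algebraMap A R '' t))
  have huB : u ∈ B := Algebra.subset_adjoin (Set.mem_insert _ _)
  have hAB (a : A) : algebraMap A R a ∈ B := by
    have h1 : (⊤ : Subalgebra K A).map (IsScalarTower.toAlgHom K A R) ≤ B := by
      rw [← ht, AlgHom.map_adjoin]
      exact Algebra.adjoin_mono (Set.subset_insert _ _)
    exact h1 ⟨a, trivial, rfl⟩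
  have hDt (i : Fin d) (a : A) (ha : a ∈ t) : D i (algebraMap A R a) ∈ B := by
    obtain ⟨c, hc⟩ := hs (i, ⟨a, ha⟩)
    have : D i (algebraMap A R a) = algebraMap A R c * u := by
      rw [hc, Algebra.smul_def, mul_assoc, mul_comm _ u, ← mul_assoc, hu, one_mul]
    rw [this]
    exact mul_mem (hAB c) huB
  refine ⟨B, ?_, hAB, fun i => ?_⟩
  · classical
    exact ⟨insert u (t.image (algebraMap A R)), by simp [B]⟩
  -- the elements whose derivatives lie in `B` form a subalgebra
  let C : Subalgebra K R :=
    { carrier := {r | r ∈ B ∧ D i r ∈ B}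
      mul_mem' := fun {a b} ha hb => ⟨mul_mem ha.1 hb.1, by
        rw [Derivation.leibniz, smul_eq_mul, smul_eq_mul]
        exact add_mem (mul_mem ha.1 hb.2) (mul_mem hb.1 ha.2)⟩
      add_mem' := fun {a b} ha hb => ⟨add_mem ha.1 hb.1, by
        rw [map_add]; exact add_mem ha.2 hb.2⟩
      algebraMap_mem' := fun c => ⟨B.algebraMap_mem c, by
        rw [Derivation.map_algebraMap]; exact zero_mem B⟩ }
  have hmem (r : R) : r ∈ C ↔ r ∈ B ∧ D i r ∈ B := Iff.rfl
  have hAC (a : A) : algebraMap A R a ∈ C := by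
    have h1 : (⊤ : Subalgebra K A).map (IsScalarTower.toAlgHom K A R) ≤ C := by
      rw [← ht, AlgHom.map_adjoin, Algebra.adjoin_le_iff]
      rintro _ ⟨a, ha, rfl⟩
      exact ⟨hAB a, hDt i a ha⟩
    exact h1 ⟨a, trivial, rfl⟩
  have hBC : B ≤ C := by
    refine Algebra.adjoin_le_iff.2 (Set.insert_subset ⟨huB, ?_⟩ ?_)
    · have h1 : D i u = -(u * u * D i (algebraMap A R s)) := by
        have h2 := congrArg (D i) hu
        rw [Derivation.leibniz, Derivation.map_one_eq_zero, smul_eq_mul, smul_eq_mul] at h2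
        linear_combination u * h2 - D i u * hu
      rw [h1]
      exact neg_mem (mul_mem (mul_mem huB huB) ((hmem _).1 (hAC s)).2)
    · rintro _ ⟨a, -, rfl⟩
      exact hAC a
  exact fun r hr => (hBC hr).2

/-- The restriction of a derivation to a stable subalgebra. -/
def derivationRestrict (B : Subalgebra K R) (D : Derivation K R R) (h : ∀ r ∈ B, D r ∈ B) :
    Derivation K B B :=
  Derivation.mk' (((D : R →ₗ[K] R).comp B.val.toLinearMap).codRestrict
    (Subalgebra.toSubmodule B) fun r => h r r.2) fun _ _ => Subtype.ext (D.leibniz _ _)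

/-- Variant of `isGanOfType_graphAut` for vector fields on a localization of an algebra of finite
type: they are defined over a subalgebra of finite type. -/
theorem isGanOfType_graphAut_of_isLocalization {K A R : Type*} [Field K] [NumberField K]
    [CommRing A] [Algebra K A] [CommRing R] [Algebra K R]
    [Algebra A R] [IsScalarTower K A R] [Algebra.FiniteType K A] (S : Submonoid A)
    [IsLocalization S R] (D : Fin d → Derivation K R R) (ev : R →ₐ[K] K) (x : Fin n → A)
    (h : d ≤ n) {g : Fin n → MvPowerSeries (Fin d) K}
    (hg : ∀ j, MvPowerSeries.constantCoeff (g j) = 0)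
    (hx : ∀ j I, ∃ w : List (Fin d), w.length = I.degree ∧
      (multiFactorial I : K) * MvPowerSeries.coeff I (g j) =
        ev (iterWord (fun i => D i) w (algebraMap A R (x j)))) :
    IsGanOfType 1 (graphAut h g) := by
  obtain ⟨B, hB, hAB, hD⟩ := exists_stable_subalgebra (K := K) S D
  have : Algebra.FiniteType K B := (Subalgebra.fg_iff_finiteType B).1 hB
  refine isGanOfType_graphAut h hg (fun i => derivationRestrict B (D i) (hD i))
    (ev.comp B.val) (fun j => ⟨_, hAB (x j)⟩) fun j I => ?_
  obtain ⟨w, hw, hwI⟩ := hx j I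
  refine ⟨w, hw, ?_⟩
  rw [hwI, AlgHom.comp_apply, map_iterWord (E := fun i => D i) B.val fun i a => rfl]
  rfl

/-- Let `b` be a basis of a direct summand of the module of vector fields of an algebra `A` of
finite type. Then the values of the vector fields `b_i` at a rational point `ev` with étale
coordinates `y` are linearly independent: if `∑ c_i b_i` vanishes at the point, then it is a
combination of the `∂/∂y_j` with coefficients in the maximal ideal of the local ring. After
multiplication by an element that does not vanish at the point this relation holds over `A`, and the
`i`-th coordinate of the projection to `F` shows that `c_i` vanishes at the point. -/
theorem eq_zero_of_isCompl [Algebra.FiniteType K A] (S : Submonoid A) [IsLocalization S R]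
    {F G : Submodule A (Derivation K A A)} (hFG : IsCompl F G) (b : Module.Basis (Fin d) A F)
    {y : Fin n → R} (hy : (MvPolynomial.aeval (R := K) y).toRingHom.FormallyEtale)
    (ev : R →ₐ[K] K) (D : Fin d → Derivation K R R)
    (hD : ∀ i a, D i (algebraMap A R a) = algebraMap A R ((b i : Derivation K A A) a))
    (c : Fin d → K) (hc : ∀ j, ∑ i, c i * ev (D i (y j)) = 0) : c = 0 := by
  classical
  have : IsNoetherianRing A := Algebra.FiniteType.isNoetherianRing K A
  have : Module.FinitePresentation A (Ω[A⁄K]) := Module.finitePresentation_of_finite A _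
  obtain ⟨δ, hδ⟩ := exists_partial hy
  -- multiples of the coordinate vector fields are defined over `A`
  have hlift (j : Fin n) : ∃ (E : Derivation K A A) (s : S), ∀ a,
      algebraMap A R (E a) = algebraMap A R s * δ j (algebraMap A R a) := by
    obtain ⟨l, s, hl⟩ := Module.FinitePresentation.exists_lift_of_isLocalizedModule S
      (Algebra.linearMap A R) ((δ j).compAlgebraMap A).liftKaehlerDifferential
    refine ⟨l.compDer (KaehlerDifferential.D K A), s, fun a => ?_⟩
    have := LinearMap.congr_fun hl (KaehlerDifferential.D K A a)
    simpa [Algebra.smul_def, Submonoid.smul_def] using this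
  choose E s hE using hlift
  let β (j : Fin n) : R := ∑ i, algebraMap K R (c i) * D i (y j)
  have hβ (j : Fin n) : ev (β j) = 0 := by
    simp only [β, map_sum, map_mul, AlgHom.commutes]
    exact hc j
  obtain ⟨t, ht⟩ := IsLocalization.exist_integer_multiples_of_finite S
    fun j => β j * IsLocalization.mk' R 1 (s j)
  choose a ha using ht
  have hev0 (u : S) : ev (algebraMap A R u) ≠ 0 :=
    ((IsLocalization.map_units R u).map ev).ne_zero
  have ha0 (j : Fin n) : ev (algebraMap A R (a j)) = 0 := by
    rw [ha, Algebra.smul_def, map_mul, map_mul, hβ, zero_mul, mul_zero]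
  let E₁ : Derivation K A A := ∑ i, ((t : A) * algebraMap K A (c i)) • (b i : Derivation K A A)
  let E₂ : Derivation K A A := ∑ j, a j • E j
  have h12 (f : A) : algebraMap A R (E₁ f) = algebraMap A R (E₂ f) := by
    have hsum : ∑ i, algebraMap K R (c i) • D i = ∑ j, β j • δ j :=
      derivation_ext_of_etale hy fun k => by
        rw [derivation_sum_smul_apply, derivation_sum_smul_apply]
        simp [hδ, β]
    have hsum' := DFunLike.congr_fun hsum (algebraMap A R f)
    rw [derivation_sum_smul_apply, derivation_sum_smul_apply] at hsum'
    simp only [E₁, E₂]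
    rw [derivation_sum_smul_apply, derivation_sum_smul_apply, map_sum, map_sum]
    have h1 (i : Fin d) :
        algebraMap A R (((t : A) * algebraMap K A (c i)) • (b i : Derivation K A A) f) =
          algebraMap A R t * (algebraMap K R (c i) • D i (algebraMap A R f)) := by
      rw [smul_eq_mul, map_mul, map_mul, ← IsScalarTower.algebraMap_apply, hD, smul_eq_mul,
        mul_assoc]
    have h2 (j : Fin n) : algebraMap A R (a j • E j f) =
        algebraMap A R t * (β j • δ j (algebraMap A R f)) := by
      have h3 : IsLocalization.mk' R 1 (s j) * algebraMap A R (s j) = 1 := by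
        rw [IsLocalization.mk'_spec, map_one]
      rw [smul_eq_mul, smul_eq_mul, map_mul, ha, hE, Algebra.smul_def]
      linear_combination algebraMap A R t * β j * δ j (algebraMap A R f) * h3
    rw [Finset.sum_congr rfl fun i _ => h1 i, Finset.sum_congr rfl fun j _ => h2 j,
      ← Finset.mul_sum, ← Finset.mul_sum, hsum']
  obtain ⟨u, hu⟩ := Module.Finite.exists_smul_of_comp_eq_of_isLocalizedModule S
    (Algebra.linearMap A R) E₁.liftKaehlerDifferential E₂.liftKaehlerDifferential
    (Derivation.liftKaehlerDifferential_unique _ _ (by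
      ext f
      simpa using h12 f))
  have hu' : (u : A) • E₁ = (u : A) • E₂ := by
    ext f
    have := LinearMap.congr_fun hu (KaehlerDifferential.D K A f)
    simpa [Submonoid.smul_def] using this
  let Φ (i : Fin d) : Derivation K A A →ₗ[A] A := b.coord i ∘ₗ F.projectionOnto G hFG
  have hΦ (i k : Fin d) : Φ i (b k) = if k = i then 1 else 0 := by
    simp only [Φ, LinearMap.comp_apply, Submodule.projectionOnto_apply_left]
    simp [Finsupp.single_apply]
  funext i
  have h1 := congrArg (fun D => ev (algebraMap A R (Φ i D))) hu'
  simp only [E₁, E₂, map_smul, map_sum, smul_eq_mul, map_mul, hΦ, ha0] at h1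
  simp only [zero_mul, Finset.sum_const_zero, mul_zero, mul_eq_zero, hev0, false_or] at h1
  simpa [hev0, ← IsScalarTower.algebraMap_apply] using h1

end FiniteType

/-! ### Functions on a scheme over a field near a rational point -/

section Sections

variable {K : Type u} [Field K] {X : Scheme.{u}} [X.Over (Spec (.of K))]

theorem algebraMap_sections (W : X.Opens) :
    algebraMap K Γ(X, W) =
      ((Scheme.ΓSpecIso (.of K)).inv ≫ (X ↘ Spec (.of K)).appLE ⊤ W le_top).hom :=
  rfl

theorem germ_algebraMap {x : X} {W : X.Opens} (hx : x ∈ W) (c : K) :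
    (X.presheaf.germ W x hx).hom (algebraMap K Γ(X, W) c) =
      algebraMap K (X.presheaf.stalk x) c :=
  X.presheaf.germ_res_apply (homOfLE le_top) x hx _

/-- The stalk at `x` as an algebra over the functions on a neighbourhood of `x`. -/
noncomputable abbrev germAlgebra {x : X} {W : X.Opens} (hx : x ∈ W) :
    Algebra Γ(X, W) (X.presheaf.stalk x) :=
  (X.presheaf.germ W x hx).hom.toAlgebra

theorem isScalarTower_germ {x : X} {W : X.Opens} (hx : x ∈ W) :
    letI := germAlgebra hx
    IsScalarTower K Γ(X, W) (X.presheaf.stalk x) :=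
  letI := germAlgebra hx
  IsScalarTower.of_algebraMap_eq fun c => (germ_algebraMap hx c).symm

theorem isLocalization_germ {x : X} {W : X.Opens} (hW : IsAffineOpen W) (hx : x ∈ W) :
    letI := germAlgebra hx
    ∃ S : Submonoid Γ(X, W), IsLocalization S (X.presheaf.stalk x) :=
  ⟨_, hW.isLocalization_stalk ⟨x, hx⟩⟩

theorem isLocalization_restrict {W : X.Opens} (hW : IsAffineOpen W) (f : Γ(X, W)) {W' : X.Opens}
    (hW' : W' = X.basicOpen f) (h : W' ≤ W) :
    letI := (X.presheaf.map (homOfLE h).op).hom.toAlgebra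
    IsLocalization.Away f Γ(X, W') := by
  subst hW'
  exact hW.isLocalization_basicOpen f

theorem finiteType_sections [LocallyOfFiniteType (X ↘ Spec (.of K))] {W : X.Opens}
    (hW : IsAffineOpen W) : Algebra.FiniteType K Γ(X, W) := by
  rw [← RingHom.finiteType_algebraMap, algebraMap_sections, CommRingCat.hom_comp]
  refine RingHom.FiniteType.comp
    ((X ↘ Spec (.of K)).finiteType_appLE (isAffineOpen_top _) hW _) ?_
  exact RingHom.FiniteType.of_surjective _
    (ConcreteCategory.bijective_of_isIso (Scheme.ΓSpecIso (.of K)).inv).2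

section Projective

attribute [local instance] MvPolynomial.gradedAlgebra

theorem finiteType_homogeneousSubmodule_zero (N : ℕ) :
    Algebra.FiniteType (MvPolynomial.homogeneousSubmodule (Fin (N + 1)) K 0)
      (MvPolynomial (Fin (N + 1)) K) := by
  have h : (algebraMap (MvPolynomial.homogeneousSubmodule (Fin (N + 1)) K 0)
      (MvPolynomial (Fin (N + 1)) K)).comp (algebraMap K _) = algebraMap K _ := rfl
  rw [← RingHom.finiteType_algebraMap]
  refine RingHom.FiniteType.of_comp_finiteType (f := algebraMap K _) ?_
  rw [h, RingHom.finiteType_algebraMap]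
  infer_instance

theorem locallyOfFiniteType_of_isProjective (hX : IsProjective K X) :
    LocallyOfFiniteType (X ↘ Spec (.of K)) := by
  obtain ⟨N, i, hi, hiX⟩ := hX
  rw [← hiX]
  have h0 := finiteType_homogeneousSubmodule_zero (K := K) N
  have h1 : LocallyOfFiniteType
      (Proj.toSpecZero (MvPolynomial.homogeneousSubmodule (Fin (N + 1)) K)) := inferInstance
  have h2 : LocallyOfFiniteType (Spec.map (CommRingCat.ofHom
      (algebraMap K (MvPolynomial.homogeneousSubmodule (Fin (N + 1)) K 0)))) := by
    rw [HasRingHomProperty.Spec_iff (P := @LocallyOfFiniteType)]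
    refine RingHom.FiniteType.of_surjective _ fun p => ?_
    obtain ⟨p, hp⟩ := p
    refine ⟨MvPolynomial.coeff 0 p, Subtype.ext ?_⟩
    have := (MvPolynomial.totalDegree_eq_zero_iff_eq_C (p := p)).1
      ((MvPolynomial.totalDegree_zero_iff_isHomogeneous _).2 hp)
    exact this.symm
  have h3 : LocallyOfFiniteType (projectiveSpaceToSpec K N) :=
    @locallyOfFiniteType_comp _ _ _ _ _ h1 h2
  infer_instance

end Projective

/-- The evaluation of germs of functions at a rational point. -/
theorem exists_evaluation (P : Spec (.of K) ⟶ X) (hP : P ≫ X ↘ Spec (.of K) = 𝟙 (Spec (.of K))) :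
    Nonempty (X.presheaf.stalk (point P) →ₐ[K] K) := by
  refine ⟨{ toRingHom := (Scheme.stalkClosedPointTo P).hom, commutes' := fun c => ?_ }⟩
  have h1 := Scheme.germ_stalkClosedPointTo P ⊤ trivial
  have h2 : (Scheme.ΓSpecIso (.of K)).inv ≫ (X ↘ Spec (.of K)).appTop ≫ P.appTop ≫
      (Scheme.ΓSpecIso (.of K)).hom = 𝟙 _ := by
    rw [← Scheme.Hom.comp_appTop_assoc, hP]
    simp
  have h4 : P.app ⊤ ≫ ((Spec (.of K)).presheaf.mapIso (eqToIso
      (Scheme.preimage_eq_top_of_closedPoint_mem P (U := ⊤) trivial).symm).op ≪≫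
        Scheme.ΓSpecIso (.of K)).hom = P.appTop ≫ (Scheme.ΓSpecIso (.of K)).hom := by
    have h6 : (Spec (.of K)).presheaf.map (eqToHom
        (Scheme.preimage_eq_top_of_closedPoint_mem P (U := ⊤) trivial).symm).op = 𝟙 _ :=
      (Spec (.of K)).presheaf.map_id _
    exact (congrArg (fun φ => P.app ⊤ ≫ φ ≫ (Scheme.ΓSpecIso (.of K)).hom) h6).trans rfl
  have h3 := congrArg (fun φ => (Scheme.ΓSpecIso (.of K)).inv ≫ (X ↘ Spec (.of K)).appTop ≫ φ)
    (h1.trans h4)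
  have h5 := congrArg (fun φ => φ.hom c) (h3.trans h2)
  exact h5

end Sections

/-! ### Étale coordinates at a smooth rational point -/

section Coordinates

section Rings

variable {K A : Type u} [Field K] [CommRing A] [Algebra K A] {n : ℕ} {x : Fin n → A}

theorem etale_aeval_translate (hx : (MvPolynomial.aeval (R := K) x).toRingHom.Etale)
    (c : Fin n → K) :
    (MvPolynomial.aeval (R := K) fun i => x i - algebraMap K A (c i)).toRingHom.Etale := by
  let τ (c : Fin n → K) : MvPolynomial (Fin n) K →ₐ[K] MvPolynomial (Fin n) K :=
    MvPolynomial.aeval fun i => MvPolynomial.X i - MvPolynomial.C (c i)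
  have hτ (c : Fin n → K) (p) : τ c (τ (-c) p) = p := by
    have : (τ c).comp (τ (-c)) = AlgHom.id K _ := by
      ext i : 1
      simp [τ, MvPolynomial.algHom_C]
    exact DFunLike.congr_fun this p
  have hbij : Function.Bijective (τ c) :=
    ⟨Function.LeftInverse.injective (g := τ (-c)) fun p => by
      simpa using hτ (-c) p, fun p => ⟨_, hτ c p⟩⟩
  have hcomp : (MvPolynomial.aeval (R := K) fun i => x i - algebraMap K A (c i)) =
      (MvPolynomial.aeval x).comp (τ c) := by
    ext i
    simp [τ, MvPolynomial.algHom_C]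
  rw [hcomp]
  have h : ((MvPolynomial.aeval (R := K) x).toRingHom.comp (τ c).toRingHom).Etale :=
    RingHom.Etale.stableUnderComposition _ _ (RingHom.Etale.of_bijective hbij) hx
  exact h

theorem etale_aeval_perm (hx : (MvPolynomial.aeval (R := K) x).toRingHom.Etale)
    (σ : Equiv.Perm (Fin n)) :
    (MvPolynomial.aeval (R := K) fun i => x (σ i)).toRingHom.Etale := by
  have hcomp : (MvPolynomial.aeval (R := K) fun i => x (σ i)) =
      (MvPolynomial.aeval x).comp (MvPolynomial.rename σ) := by
    ext i
    simp
  rw [hcomp]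
  have h : ((MvPolynomial.aeval (R := K) x).toRingHom.comp
      (MvPolynomial.rename (R := K) σ).toRingHom).Etale :=
    RingHom.Etale.stableUnderComposition _ _
      (RingHom.Etale.of_bijective (MvPolynomial.renameEquiv K σ).bijective) hx
  exact h

theorem formallyEtale_aeval_of_isLocalization {R : Type*} [CommRing R] [Algebra K R] [Algebra A R]
    [IsScalarTower K A R] (S : Submonoid A) [IsLocalization S R]
    (hx : (MvPolynomial.aeval (R := K) x).toRingHom.Etale) :
    (MvPolynomial.aeval (R := K) fun i => algebraMap A R (x i)).toRingHom.FormallyEtale := by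
  have hcomp : (MvPolynomial.aeval (R := K) fun i => algebraMap A R (x i)) =
      (IsScalarTower.toAlgHom K A R).comp (MvPolynomial.aeval x) := by
    ext i
    simp
  have h1 : (MvPolynomial.aeval (R := K) x).toRingHom.FormallyEtale := hx.1
  have h2 : (algebraMap A R).FormallyEtale :=
    RingHom.formallyEtale_algebraMap.2 (Algebra.FormallyEtale.of_isLocalization S)
  rw [hcomp]
  exact h1.comp h2

theorem finiteType_of_etale_aeval (hx : (MvPolynomial.aeval (R := K) x).toRingHom.Etale) :
    Algebra.FiniteType K A := by
  have h1 : (MvPolynomial.aeval (R := K) x).toRingHom.FiniteType :=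
    RingHom.FiniteType.of_finitePresentation hx.2
  have h2 : (algebraMap K (MvPolynomial (Fin n) K)).FiniteType :=
    RingHom.finiteType_algebraMap.2 inferInstance
  have h3 := h1.comp h2
  rw [← RingHom.finiteType_algebraMap]
  convert h3
  exact (MvPolynomial.aeval (R := K) x).comp_algebraMap.symm

end Rings

variable {K : Type u} [Field K] {X : Scheme.{u}} [X.Over (Spec (.of K))]

/-- Étale coordinates exist at a smooth rational point: a smooth morphism is locally étale over an
affine space, and translations make the coordinates vanish at the point. -/
theorem exists_etaleCoords {x : X} (hs : IsSmoothAt K x)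
    (ev : X.presheaf.stalk x →ₐ[K] K) : ∃ n, Nonempty (EtaleCoords K x n) := by
  obtain ⟨W, hxW, hW⟩ := hs
  obtain ⟨U, hU, V, hV, hxV, e, hst⟩ :=
    Smooth.exists_isStandardSmooth (W.ι ≫ X ↘ Spec (.of K)) ⟨x, hxW⟩
  obtain rfl : U = ⊤ := by
    have : Subsingleton (Spec (.of K)) := inferInstanceAs (Subsingleton (PrimeSpectrum K))
    refine top_le_iff.1 fun z _ => ?_
    have h1 := e hxV
    rwa [Subsingleton.elim z ((W.ι ≫ X ↘ Spec (.of K)) ⟨x, hxW⟩)]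
  obtain ⟨n, g, hgC, hg⟩ := hst.exists_etale_mvPolynomial
  have hxV' : x ∈ W.ι ''ᵁ V := ⟨⟨x, hxW⟩, hxV, rfl⟩
  let κ : K →+* Γ(Spec (.of K), ⊤) := (Scheme.ΓSpecIso (.of K)).inv.hom
  let ι : Γ(W, V) →+* Γ(X, W.ι ''ᵁ V) := (W.ι.appIso V).inv.hom
  have hcomp : ι.comp ((((W.ι ≫ X ↘ Spec (.of K)).appLE ⊤ V e).hom).comp κ) =
      algebraMap K Γ(X, W.ι ''ᵁ V) := by
    rw [algebraMap_sections]
    have h1 : (W.ι ≫ X ↘ Spec (.of K)).appLE ⊤ V e ≫ (W.ι.appIso V).inv =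
        (X ↘ Spec (.of K)).appLE ⊤ (W.ι ''ᵁ V) le_top := by
      rw [Scheme.Hom.comp_appLE, Category.assoc]
      exact congrArg (fun φ => (X ↘ Spec (.of K)).app ⊤ ≫ φ)
        (Scheme.Hom.appLE_appIso_inv W.ι (U := (X ↘ Spec (.of K)) ⁻¹ᵁ ⊤) e)
    rw [← h1]
    rfl
  let p : MvPolynomial (Fin n) K →+* Γ(X, W.ι ''ᵁ V) := ι.comp (g.comp (MvPolynomial.map κ))
  have hp : p.Etale := by
    refine RingHom.Etale.stableUnderComposition _ _ (RingHom.Etale.stableUnderComposition _ _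
      (RingHom.Etale.of_bijective (f := MvPolynomial.map κ) ?_) hg)
      (RingHom.Etale.of_bijective (f := ι) (ConcreteCategory.bijective_of_isIso _))
    have : Function.Bijective κ := ConcreteCategory.bijective_of_isIso _
    exact ⟨MvPolynomial.map_injective _ this.1, MvPolynomial.map_surjective _ this.2⟩
  have hp' : p = (MvPolynomial.aeval (R := K) fun i => p (.X i)).toRingHom := by
    refine MvPolynomial.ringHom_ext (fun c => ?_) fun i => ?_
    · have h1 : g (MvPolynomial.C (κ c)) = ((W.ι ≫ X ↘ Spec (.of K)).appLE ⊤ V e).hom (κ c) :=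
        RingHom.congr_fun hgC (κ c)
      have h2 := RingHom.congr_fun hcomp c
      simp only [p, RingHom.comp_apply, MvPolynomial.map_C, h1] at h2 ⊢
      rw [h2]
      exact (MvPolynomial.aeval_C _ c).symm
    · exact (MvPolynomial.aeval_X (R := K) (fun i => p (.X i)) i).symm
  rw [hp'] at hp
  refine ⟨n, ⟨⟨W.ι ''ᵁ V, hV.image_of_isOpenImmersion W.ι, hxV', _, fun i => ?_,
    etale_aeval_translate hp fun i =>
      ev ((X.presheaf.germ (W.ι ''ᵁ V) x hxV').hom (p (.X i)))⟩⟩⟩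
  refine (mem_maximalIdeal_iff_of_algHom ev _).2 ?_
  change ev ((X.presheaf.germ (W.ι ''ᵁ V) x hxV').hom (_ - _)) = 0
  rw [map_sub, map_sub, germ_algebraMap, AlgHom.commutes]
  exact sub_self _

end Coordinates

/-! ### Germs of vector fields -/

section Germs

variable {K : Type u} [Field K] {X : Scheme.{u}} [X.Over (Spec (.of K))] {x : X}

/-- The derivation `E` of the local ring at `x` is the germ of the vector field `D`. -/
def IsGerm {W : X.Opens} (hx : x ∈ W) (D : VectorField K X W)
    (E : Derivation K (X.presheaf.stalk x) (X.presheaf.stalk x)) : Prop :=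
  ∀ s, E ((X.presheaf.germ W x hx).hom s) = (X.presheaf.germ W x hx).hom (D s)

theorem exists_isGerm {W : X.Opens} (hW : IsAffineOpen W) (hx : x ∈ W) (D : VectorField K X W) :
    ∃ E, IsGerm hx D E := by
  let := germAlgebra hx
  have := isScalarTower_germ (K := K) hx
  obtain ⟨S, hS⟩ := isLocalization_germ hW hx
  have := Algebra.FormallyEtale.of_isLocalization (Rₘ := X.presheaf.stalk x) S
  exact exists_derivation_extension
    ((Algebra.linearMap Γ(X, W) (X.presheaf.stalk x)).compDer D)

theorem derivation_stalk_ext {W : X.Opens} (hW : IsAffineOpen W) (hx : x ∈ W) {M : Type*}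
    [AddCommGroup M] [Module (X.presheaf.stalk x) M] [Module K M]
    [IsScalarTower K (X.presheaf.stalk x) M] {D E : Derivation K (X.presheaf.stalk x) M}
    (h : ∀ s, D ((X.presheaf.germ W x hx).hom s) = E ((X.presheaf.germ W x hx).hom s)) :
    D = E := by
  let := germAlgebra hx
  obtain ⟨S, hS⟩ := isLocalization_germ hW hx
  have := Algebra.FormallyEtale.of_isLocalization (Rₘ := X.presheaf.stalk x) S
  exact derivation_ext_of_formallyUnramified h

theorem IsGerm.eq {W : X.Opens} (hW : IsAffineOpen W) {hx : x ∈ W} {D : VectorField K X W}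
    {E E'} (h : IsGerm hx D E) (h' : IsGerm hx D E') : E = E' :=
  derivation_stalk_ext hW hx fun s => (h s).trans (h' s).symm

theorem IsGerm.zero {W : X.Opens} (hx : x ∈ W) : IsGerm hx (0 : VectorField K X W) 0 :=
  fun s => by simp

theorem IsGerm.add {W : X.Opens} {hx : x ∈ W} {D D' : VectorField K X W} {E E'}
    (h : IsGerm hx D E) (h' : IsGerm hx D' E') : IsGerm hx (D + D') (E + E') :=
  fun s => by rw [Derivation.add_apply, Derivation.add_apply, map_add, h, h']

theorem IsGerm.smul {W : X.Opens} {hx : x ∈ W} {D : VectorField K X W} {E}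
    (h : IsGerm hx D E) (f : Γ(X, W)) :
    IsGerm hx (f • D) ((X.presheaf.germ W x hx).hom f • E) :=
  fun s => by
    rw [Derivation.smul_apply, Derivation.smul_apply, h, smul_eq_mul, smul_eq_mul, map_mul]

theorem IsGerm.lie {W : X.Opens} {hx : x ∈ W} {D D' : VectorField K X W} {E E'}
    (h : IsGerm hx D E) (h' : IsGerm hx D' E') : IsGerm hx ⁅D, D'⁆ ⁅E, E'⁆ :=
  fun s => by
    rw [Derivation.commutator_apply, Derivation.commutator_apply, h, h', h, h', map_sub]

theorem IsGerm.restrict {W W' : X.Opens} (hW : IsAffineOpen W) (hW' : IsAffineOpen W')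
    (hWW' : W' ≤ W) {hx : x ∈ W'} {D : VectorField K X W} {D' : VectorField K X W'}
    (hr : IsRestriction hWW' D D') {E} (h : IsGerm (hWW' hx) D E) : IsGerm hx D' E := by
  obtain ⟨E', hE'⟩ := exists_isGerm hW' hx D'
  have : E' = E := derivation_stalk_ext hW (hWW' hx) fun s => by
    rw [h, ← X.presheaf.germ_res_apply (homOfLE hWW') x hx s,
      ← X.presheaf.germ_res_apply (homOfLE hWW') x hx (D s)]
    exact (hE' _).trans (congrArg _ (hr s))
  exact this ▸ hE'

variable {U : X.Opens} {d : ℕ} (F : AlgFoliation K X U d)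

/-- The germs at `x` of the vector fields that belong to a foliation, read on an affine open
neighbourhood `W` of `x`. -/
noncomputable def stalkFields {W : X.Opens} (hW : IsAffineOpen W) (hWU : W ≤ U) (hx : x ∈ W) :
    Submodule (X.presheaf.stalk x) (Derivation K (X.presheaf.stalk x) (X.presheaf.stalk x)) :=
  Submodule.span _ {E | ∃ D ∈ F.fields W hW hWU, IsGerm hx D E}

/-- Restriction to a smaller neighbourhood does not add germs to a foliation. -/
theorem stalkFields_le {W W' : X.Opens} (hW : IsAffineOpen W) (hW' : IsAffineOpen W')
    (hWU : W ≤ U) (h : W' ≤ W) (hx : x ∈ W') :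
    stalkFields F hW' (h.trans hWU) hx ≤ stalkFields F hW hWU (h hx) := by
  refine Submodule.span_le.2 ?_
  rintro E ⟨D, hD, hDE⟩
  rw [F.fields_restrict W W' hW hW' hWU h] at hD
  suffices h : ∃ E ∈ stalkFields F hW hWU (h hx), IsGerm hx D E by
    obtain ⟨E', hE', hDE'⟩ := h
    rwa [hDE.eq hW' hDE']
  clear hDE
  induction hD using Submodule.span_induction with
  | mem D' hD' =>
    obtain ⟨D, hD, hr⟩ := hD'
    obtain ⟨E, hE⟩ := exists_isGerm hW (h hx) D
    exact ⟨E, Submodule.subset_span ⟨D, hD, hE⟩, hE.restrict hW hW' h hr⟩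
  | zero => exact ⟨0, zero_mem _, IsGerm.zero hx⟩
  | add D₁ D₂ _ _ h₁ h₂ =>
    obtain ⟨E₁, hE₁, h₁⟩ := h₁
    obtain ⟨E₂, hE₂, h₂⟩ := h₂
    exact ⟨_, add_mem hE₁ hE₂, h₁.add h₂⟩
  | smul f D _ h =>
    obtain ⟨E, hE, h⟩ := h
    exact ⟨_, Submodule.smul_mem _ _ hE, h.smul f⟩

/-- Restriction to a basic open neighbourhood loses no germ, as vector fields extend to
localizations. -/
theorem le_stalkFields {W W' : X.Opens} (hW : IsAffineOpen W) (hW' : IsAffineOpen W')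
    (hWU : W ≤ U) (f : Γ(X, W)) (hf : W' = X.basicOpen f) (h : W' ≤ W) (hx : x ∈ W') :
    stalkFields F hW hWU (h hx) ≤ stalkFields F hW' (h.trans hWU) hx := by
  refine Submodule.span_le.2 ?_
  rintro E ⟨D, hD, hDE⟩
  let := (X.presheaf.map (homOfLE h).op).hom.toAlgebra
  have : IsScalarTower K Γ(X, W) Γ(X, W') := IsScalarTower.of_algebraMap_eq fun c => by
    change _ = ((X.presheaf.map (homOfLE le_top : W ⟶ ⊤).op) ≫
      (X.presheaf.map (homOfLE h).op)).hom (toGlobal K X c)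
    rw [← Functor.map_comp]
    rfl
  have := isLocalization_restrict hW f hf h
  have := Algebra.FormallyEtale.of_isLocalization (Rₘ := Γ(X, W')) (Submonoid.powers f)
  obtain ⟨D', hD'⟩ := exists_derivation_extension
    ((Algebra.linearMap Γ(X, W) Γ(X, W')).compDer D)
  refine Submodule.subset_span ⟨D', ?_, hDE.restrict hW hW' h hD'⟩
  rw [F.fields_restrict W W' hW hW' hWU h]
  exact Submodule.subset_span ⟨D, hD, hD'⟩

/-- The germs of the vector fields of a foliation can be computed on any affine open
neighbourhood. -/
theorem stalkFields_eq {W W' : X.Opens} (hW : IsAffineOpen W) (hW' : IsAffineOpen W')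
    (hWU : W ≤ U) (hWU' : W' ≤ U) (hx : x ∈ W) (hx' : x ∈ W') :
    stalkFields F hW hWU hx = stalkFields F hW' hWU' hx' := by
  obtain ⟨f, g, hfg, hxf⟩ := exists_basicOpen_le_affine_inter hW hW' x ⟨hx, hx'⟩
  have hle : X.basicOpen f ≤ W' := hfg.trans_le (X.basicOpen_le g)
  refine le_antisymm ?_ ?_
  · exact (le_stalkFields F hW (hW.basicOpen f) hWU f rfl (X.basicOpen_le f) hxf).trans
      (stalkFields_le F hW' (hW.basicOpen f) hWU' hle hxf)
  · exact (le_stalkFields F hW' (hW.basicOpen f) hWU' g hfg hle hxf).trans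
      (stalkFields_le F hW (hW.basicOpen f) hWU (X.basicOpen_le f) hxf)

/-- The germs of a basis of a foliation span the germs of its vector fields. -/
theorem stalkFields_eq_span_range {W : X.Opens} (hW : IsAffineOpen W) (hWU : W ≤ U) (hx : x ∈ W)
    (b : Module.Basis (Fin d) Γ(X, W) (F.fields W hW hWU))
    {D : Fin d → Derivation K (X.presheaf.stalk x) (X.presheaf.stalk x)}
    (hD : ∀ i, IsGerm hx (b i : VectorField K X W) (D i)) :
    stalkFields F hW hWU hx = Submodule.span _ (Set.range D) := by
  refine le_antisymm (Submodule.span_le.2 ?_) (Submodule.span_le.2 ?_)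
  · rintro E ⟨D', hD', hE⟩
    have h1 : IsGerm hx D'
        (∑ i, (X.presheaf.germ W x hx).hom (b.repr ⟨D', hD'⟩ i) • D i) := fun s => by
      have h2 : D' = ∑ i, b.repr ⟨D', hD'⟩ i • (b i : VectorField K X W) := by
        have h3 := congrArg Subtype.val (b.sum_repr ⟨D', hD'⟩)
        exact h3.symm.trans (map_sum (F.fields W hW hWU).subtype _ _)
      conv_rhs => rw [h2]
      rw [derivation_sum_smul_apply, derivation_sum_smul_apply, map_sum]
      exact Finset.sum_congr rfl fun i _ => by
        rw [smul_eq_mul, smul_eq_mul, map_mul, hD]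
    rw [hE.eq hW h1]
    exact Submodule.sum_mem _ fun i _ => Submodule.smul_mem _ _ (Submodule.subset_span ⟨i, rfl⟩)
  · rintro _ ⟨i, rfl⟩
    exact Submodule.subset_span ⟨b i, (b i).2, hD i⟩

/-- The formal subscheme with ideal `J` is tangent to the derivation `E` of the local ring. -/
def IsStalkTangent (J : Ideal (completedStalk x))
    (E : Derivation K (X.presheaf.stalk x) (X.presheaf.stalk x)) : Prop :=
  ∃ E' : Derivation K (completedStalk x ⧸ J) (completedStalk x ⧸ J), ∀ r,
    E' (Ideal.Quotient.mk J (algebraMap _ _ r)) = Ideal.Quotient.mk J (algebraMap _ _ (E r))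

theorem IsStalkTangent.of_mem_span {J : Ideal (completedStalk x)}
    {s : Set (Derivation K (X.presheaf.stalk x) (X.presheaf.stalk x))}
    (hs : ∀ E ∈ s, IsStalkTangent J E) {E}
    (hE : E ∈ Submodule.span (X.presheaf.stalk x) s) : IsStalkTangent J E := by
  induction hE using Submodule.span_induction with
  | mem E hE => exact hs E hE
  | zero => exact ⟨0, fun r => by simp⟩
  | add E₁ E₂ _ _ h₁ h₂ =>
    obtain ⟨D₁, h₁⟩ := h₁
    obtain ⟨D₂, h₂⟩ := h₂
    exact ⟨D₁ + D₂, fun r => by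
      rw [Derivation.add_apply, Derivation.add_apply, h₁, h₂, map_add, map_add]⟩
  | smul f E _ h =>
    obtain ⟨D, h⟩ := h
    exact ⟨Ideal.Quotient.mk J (algebraMap _ _ f) • D, fun r => by
      rw [Derivation.smul_apply, Derivation.smul_apply, h, smul_eq_mul, smul_eq_mul, map_mul,
        map_mul]⟩

/-- Tangency to a vector field depends only on its germ, as derivations of the functions on a
neighbourhood extend uniquely to the local ring. -/
theorem isTangent_iff {J : Ideal (completedStalk x)} {W : X.Opens} (hW : IsAffineOpen W)
    {hx : x ∈ W} {D : VectorField K X W} {E} (hE : IsGerm hx D E) :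
    IsTangent K J hx D ↔ IsStalkTangent J E := by
  constructor
  · rintro ⟨E', hE'⟩
    refine ⟨E', fun r => ?_⟩
    let δ₁ : Derivation K (X.presheaf.stalk x) (completedStalk x ⧸ J) :=
      E'.compAlgebraMap (X.presheaf.stalk x)
    let δ₂ : Derivation K (X.presheaf.stalk x) (completedStalk x ⧸ J) :=
      (Algebra.linearMap (X.presheaf.stalk x) (completedStalk x ⧸ J)).compDer E
    have : δ₁ = δ₂ := derivation_stalk_ext hW hx fun s => by
      refine (hE' s).trans ?_
      change _ = Ideal.Quotient.mk J (algebraMap _ _ (E _))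
      rw [hE]
      rfl
    exact DFunLike.congr_fun this r
  · rintro ⟨E', hE'⟩
    refine ⟨E', fun s => (hE' _).trans ?_⟩
    rw [hE]
    rfl

/-- To be a leaf of a foliation, it suffices to be smooth and tangent to generators of its germs at
the point. -/
theorem isFormalLeaf_iff {W : X.Opens} (hW : IsAffineOpen W) (hWU : W ≤ U) (hx : x ∈ W)
    {D : Fin d → Derivation K (X.presheaf.stalk x) (X.presheaf.stalk x)}
    (hD : stalkFields F hW hWU hx = Submodule.span _ (Set.range D))
    (J : Ideal (completedStalk x)) :
    IsFormalLeaf F x J ↔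
      IsSmoothFormalSubscheme K x d J ∧ ∀ i, IsStalkTangent J (D i) := by
  constructor
  · intro h
    refine ⟨h.smooth, fun i => ?_⟩
    have hi : D i ∈ stalkFields F hW hWU hx := hD.ge (Submodule.subset_span ⟨i, rfl⟩)
    refine IsStalkTangent.of_mem_span ?_ hi
    rintro E ⟨D', hD', hE⟩
    exact (isTangent_iff hW hE).1 (h.tangent W hW hWU hx D' hD')
  · rintro ⟨hs, ht⟩
    refine ⟨hs, fun W' hW' hWU' hx' D' hD' => ?_⟩
    obtain ⟨E, hE⟩ := exists_isGerm hW' hx' D'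
    refine (isTangent_iff hW' hE).2 (IsStalkTangent.of_mem_span (s := Set.range D) ?_ ?_)
    · rintro _ ⟨i, rfl⟩
      exact ht i
    · rw [← hD, stalkFields_eq F hW hW' hWU hWU' hx hx']
      exact Submodule.subset_span ⟨D', hD', hE⟩

end Germs

end FormalLeaf

theorem mainTheorem4 (K : Type u) [Field K] [NumberField K]
    (X : Scheme.{u}) [X.Over (Spec (.of K))] (hX : FormalLeaf.IsProjective K X)
    (P : Spec (.of K) ⟶ X) (hP : P ≫ X ↘ Spec (.of K) = 𝟙 (Spec (.of K)))
    (hsmooth : FormalLeaf.IsSmoothAt K (FormalLeaf.point P))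
    (U : X.Opens) (hPU : FormalLeaf.point P ∈ U)
    (d : ℕ) (F : FormalLeaf.AlgFoliation K X U d) :
    (∃! J : Ideal (FormalLeaf.completedStalk (FormalLeaf.point P)),
      FormalLeaf.IsFormalLeaf F (FormalLeaf.point P) J) ∧
    ∀ J : Ideal (FormalLeaf.completedStalk (FormalLeaf.point P)),
      FormalLeaf.IsFormalLeaf F (FormalLeaf.point P) J →
        FormalLeaf.IsAnalyticOfType K 1 (FormalLeaf.point P) d J := by
  open FormalLeaf in
  have := locallyOfFiniteType_of_isProjective hX
  obtain ⟨ev⟩ := exists_evaluation P hP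
  set x := point P with hx
  obtain ⟨n, ⟨c₀⟩⟩ := exists_etaleCoords hsmooth ev
  -- a basis of the foliation near `x` and its germs
  obtain ⟨W, hW, hWU, hxW, ⟨b⟩, G, hG⟩ := F.subbundle x hPU
  choose D₀ hD₀ using fun i => exists_isGerm hW hxW (b i : VectorField K X W)
  have hspan₀ := stalkFields_eq_span_range F hW hWU hxW b hD₀
  let y₀ (j : Fin n) := (X.presheaf.germ c₀.W x c₀.mem).hom (c₀.coord j)
  have hy (σ : Equiv.Perm (Fin n)) :
      (MvPolynomial.aeval (R := K) fun j => y₀ (σ j)).toRingHom.FormallyEtale := by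
    let := germAlgebra c₀.mem
    have := isScalarTower_germ (K := K) c₀.mem
    obtain ⟨S, hS⟩ := isLocalization_germ c₀.isAffine c₀.mem
    exact formallyEtale_aeval_of_isLocalization S (etale_aeval_perm c₀.etale σ)
  have hind (a : Fin d → K) (ha : ∀ j, ∑ i, a i * ev (D₀ i (y₀ j)) = 0) : a = 0 := by
    let := germAlgebra hxW
    have := isScalarTower_germ (K := K) hxW
    obtain ⟨S, hS⟩ := isLocalization_germ hW hxW
    have := finiteType_sections (K := K) hW
    exact eq_zero_of_isCompl S hG b (hy 1) ev D₀ hD₀ a ha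
  obtain ⟨h, σ, D, hspan, hDy, hcomm⟩ := exists_commuting_frame y₀ ev D₀ (fun i j => by
    rw [← hspan₀]
    exact Submodule.subset_span ⟨_, F.involutive W hW hWU _ (b i).2 _ (b j).2,
      (hD₀ i).lie (hD₀ j)⟩) hind
  let c : EtaleCoords K x n :=
    { c₀ with
      coord := fun j => c₀.coord (σ j)
      vanish := fun j => c₀.vanish (σ j)
      etale := etale_aeval_perm c₀.etale σ }
  have hft := finiteType_of_etale_aeval c.etale
  let := germAlgebra c.mem
  have := isScalarTower_germ (K := K) c.mem
  obtain ⟨S, hS⟩ := isLocalization_germ c.isAffine c.mem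
  have hN : IsNoetherianRing (X.presheaf.stalk x) := by
    have := Algebra.FiniteType.isNoetherianRing K Γ(X, c.W)
    exact IsLocalization.isNoetherianRing S _ inferInstance
  obtain ⟨J₀, g, hJs, hJt, hJu, hg0, hg, θ, hθ, hθJ⟩ := exists_unique_leaf (hy σ) ev
    (fun j => (mem_maximalIdeal_iff_of_algHom ev _).1 (c.vanish j)) h D hDy hcomm
  have hleaf := isFormalLeaf_iff F hW hWU hxW (hspan₀.trans hspan.symm)
  have huniq (J) (hJ : IsFormalLeaf F x J) : J = J₀ :=
    hJu J ((hleaf J).1 hJ).1 ((hleaf J).1 hJ).2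
  refine ⟨⟨J₀, (hleaf J₀).2 ⟨hJs, hJt⟩, huniq⟩, fun J hJ => ?_⟩
  obtain rfl := huniq J hJ
  -- the infimum defining the type is at most `1` because `graphAut h g` belongs to `G_{an,1}`
  refine sInf_le ⟨1, rfl, n, c, graphAut h g, ?_, θ, hθ, hθJ⟩
  exact isGanOfType_graphAut_of_isLocalization S D ev c.coord h hg0 hg
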